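/- Let $p$ be a prime and let $K$ be a complete discretely valued field of characteristic $0$ with valuation ring $\mathcal{O}_K$ and residue field $\kappa$ of characteristic $p$ and finite $p$-rank. A \emph{$p$-basis} of $\kappa$ is a finite set $B=\{b_1,\dots,b_n\}\subset\kappa$ such that the monomials $b_1^{s_1}\cdots b_n^{s_n}$ with $0\le s_j<p$ form a basis of $\kappa$ over $\kappa^p$. A \emph{pseudo-basis} of $K$ is a set $\Lambda=\{u_1,\dots,u_n,\pi\}$ where $\pi$ is a uniformizer of $\mathcal{O}_K$ and $u_1,\dots,u_n\in\mathcal{O}_K$ are lifts of the elements of a $p$-basis of $\kappa$. A \emph{pseudo-perfect extension of level $1$} of $K$ is a field extension $L/K$ with $L=K(\sqrt[p]{\lambda}:\lambda\in\Lambda)$ for some pseudo-basis $\Lambda$ of $K$ (one $p$-th root of each $\lambda\in\Lambda$ being adjoined). For a field $F$ let $K_i(F)$ denote the $i$-th Milnor $K$-group, the quotient of $(F^\times)^{\otimes i}$ by the subgroup generated by the tensors $x_1\otimes\cdots\otimes x_i$ with $x_r+x_s=1$ for some $r<s$. For a field $F$ of characteristic $p$ let $H^2_{\text{\'et}}(F,\mathbb{Z}/p(1))=H^1_{\text{\'et}}(F,\Omega^1_{\log})$,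 i.e. the continuous cohomology group $H^1(\mathrm{Gal}(F^{\mathrm{sep}}/F),\Omega^1_{F^{\mathrm{sep}},\log})$, where $\Omega^1_{F^{\mathrm{sep}},\log}=\{dx/x: x\in (F^{\mathrm{sep}})^\times\}\subset\Omega^1_{F^{\mathrm{sep}}}$ is the discrete Galois module of logarithmic differentials. Then for every pseudo-perfect extension $L/K$ of level $1$, the natural restriction map $$\mathrm{Res}^i_{L/K}\colon K_i(K)/p\to K_i(L)/p,\qquad \{x_1,\dots,x_i\}\mapsto\{x_1,\dots,x_i\},$$ is zero for all $i\ge 3$. Moreover, $\mathrm{Res}^2_{L/K}$ is zero if either $p\ne 2$ or $H^2_{\text{\'et}}(\kappa,\mathbb{Z}/2(1))=0$. -/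

import Mathlib

open IsLocalRing
open scoped TensorProduct

noncomputable section

/-! ### Milnor K-groups -/

section Milnor

universe u v

/-- The `n`-fold tensor power over `ℤ` of the multiplicative group `Fˣ`, written additively. -/
abbrev UnitsTensorPower (F : Type u) [Field F] (n : ℕ) : Type u :=
  ⨂[ℤ] _ : Fin n, Additive Fˣ

/-- The subgroup generated by the tensors `x₁ ⊗ ⋯ ⊗ xₙ` with `xᵢ + xⱼ = 1` for some `i < j`. -/
def steinbergRelations (F : Type u) [Field F] (n : ℕ) : Submodule ℤ (UnitsTensorPower F n) :=
  Submodule.span ℤ {t | ∃ x : Fin n → Fˣ, (∃ i j : Fin n, i < j ∧ (x i : F) + (x j : F) = 1) ∧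
    t = PiTensorProduct.tprod ℤ (fun k => Additive.ofMul (x k))}

/-- The `n`-th Milnor K-group of a field. -/
abbrev MilnorK (F : Type u) [Field F] (n : ℕ) : Type u :=
  UnitsTensorPower F n ⧸ steinbergRelations F n

/-- The map of tensor powers induced by a field homomorphism. -/
def unitsTensorPowerMap {F : Type u} {E : Type v} [Field F] [Field E] (f : F →+* E) (n : ℕ) :
    UnitsTensorPower F n →ₗ[ℤ] UnitsTensorPower E n :=
  PiTensorProduct.map fun _ : Fin n =>
    (MonoidHom.toAdditive (Units.map (f : F →* E))).toIntLinearMap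

theorem steinbergRelations_le_comap {F : Type u} {E : Type v} [Field F] [Field E]
    (f : F →+* E) (n : ℕ) :
    steinbergRelations F n ≤ (steinbergRelations E n).comap (unitsTensorPowerMap f n) := by
  refine Submodule.span_le.2 ?_
  rintro _ ⟨x, ⟨i, j, hij, hx⟩, rfl⟩
  refine Submodule.subset_span ⟨fun k => Units.map (f : F →* E) (x k), ⟨i, j, hij, ?_⟩, ?_⟩
  · simpa using congrArg f hx
  · simp only [unitsTensorPowerMap, PiTensorProduct.map_tprod]
    rfl

/-- The restriction map `K_n(F) → K_n(E)`, `{x₁, …, xₙ} ↦ {f x₁, …, f xₙ}`. -/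
def MilnorK.map {F : Type u} {E : Type v} [Field F] [Field E] (f : F →+* E) (n : ℕ) :
    MilnorK F n →ₗ[ℤ] MilnorK E n :=
  Submodule.mapQ _ _ (unitsTensorPowerMap f n) (steinbergRelations_le_comap f n)

/-- The subgroup `m · K_n(F)` of `K_n(F)`. -/
def MilnorK.multiples (F : Type u) [Field F] (m n : ℕ) : Submodule ℤ (MilnorK F n) :=
  LinearMap.range (LinearMap.lsmul ℤ (MilnorK F n) (m : ℤ))

/-- The group `K_n(F)/m`. -/
abbrev MilnorKMod (F : Type u) [Field F] (m n : ℕ) : Type u :=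
  MilnorK F n ⧸ MilnorK.multiples F m n

theorem MilnorK.multiples_le_comap {F : Type u} {E : Type v} [Field F] [Field E]
    (f : F →+* E) (m n : ℕ) :
    MilnorK.multiples F m n ≤ (MilnorK.multiples E m n).comap (MilnorK.map f n) := by
  rintro _ ⟨x, rfl⟩
  exact ⟨MilnorK.map f n x, by simp⟩

/-- The restriction map `K_n(F)/m → K_n(E)/m`. -/
def MilnorKMod.map {F : Type u} {E : Type v} [Field F] [Field E] (f : F →+* E) (m n : ℕ) :
    MilnorKMod F m n →ₗ[ℤ] MilnorKMod E m n :=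
  Submodule.mapQ _ _ (MilnorK.map f n) (MilnorK.multiples_le_comap f m n)

end Milnor

/-! ### Pseudo-perfect extensions -/

section PseudoPerfect

universe u v w

/-- A finite set `B` is a `p`-basis of a field `k` of characteristic `p`: the monomials
`∏ b ^ s_b` with `0 ≤ s_b < p` form a basis of `k` as a vector space over `k ^ p`. -/
def IsFinitePBasis (p : ℕ) {k : Type u} [Field k] [ExpChar k p] (B : Finset k) : Prop :=
  LinearIndependent (frobenius k p).fieldRange
      (fun s : B → Fin p => ∏ b : B, (b : k) ^ (s b : ℕ)) ∧
    Submodule.span (frobenius k p).fieldRange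
      (Set.range fun s : B → Fin p => ∏ b : B, (b : k) ^ (s b : ℕ)) = ⊤

/-- A pseudo-basis of `K = Frac R`, for a discrete valuation ring `R` with residue field of
characteristic `p`: a set `Λ` which consists of a uniformizer of `R` and of a lift to `R` of some
(finite) `p`-basis of the residue field, i.e. one lift of each of its elements. -/
def IsPseudoBasis (p : ℕ) (R : Type u) [CommRing R] [IsDomain R] [IsDiscreteValuationRing R]
    [ExpChar (ResidueField R) p] (K : Type v) [Field K] [Algebra R K] (Λ : Set K) : Prop :=
  ∃ (B : Finset (ResidueField R)) (lift : B → R) (ϖ : R),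
    IsFinitePBasis p B ∧ (∀ b : B, residue R (lift b) = b) ∧ Irreducible ϖ ∧
      Λ = Set.range (fun b : B => algebraMap R K (lift b)) ∪ {algebraMap R K ϖ}

/-- `L` is a pseudo-perfect extension of level `ℓ` of `K = Frac R`: it is generated over `K` by
one `p ^ ℓ`-th root of each element of some pseudo-basis of `K`. -/
def IsPseudoPerfect (p : ℕ) (R : Type u) [CommRing R] [IsDomain R] [IsDiscreteValuationRing R]
    [ExpChar (ResidueField R) p] (K : Type v) [Field K] [Algebra R K]
    (ℓ : ℕ) (L : Type w) [Field L] [Algebra K L] : Prop :=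
  ∃ Λ : Set K, IsPseudoBasis p R K Λ ∧
    ∃ root : Λ → L, (∀ a : Λ, root a ^ p ^ ℓ = algebraMap K L (a : K)) ∧
      IntermediateField.adjoin K (Set.range root) = ⊤

end PseudoPerfect

/-! ### The group `H²_ét(k, ℤ/p(1))` for a field `k` of characteristic `p` -/

section Etale

universe u v

/-- The map on absolute Kähler differentials induced by a ring homomorphism `f`:
`a • db ↦ f a • d (f b)`. -/
def kaehlerMap {A : Type u} {B : Type v} [CommRing A] [CommRing B] (f : A →+* B) :
    Ω[A⁄ℤ] →+ Ω[B⁄ℤ] :=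
  letI := f.toAlgebra
  (KaehlerDifferential.map ℤ ℤ A B).toAddMonoidHom

/-- `dlog x = x⁻¹ • dx`, as a homomorphism from `Fˣ` to `Ω¹_F`. -/
def dlog (F : Type u) [Field F] : Additive Fˣ →+ Ω[F⁄ℤ] where
  toFun x := ((x.toMul⁻¹ : Fˣ) : F) • KaehlerDifferential.D ℤ F (x.toMul : F)
  map_zero' := by simp
  map_add' x y := by
    have hx : (x.toMul : F) ≠ 0 := x.toMul.ne_zero
    have hy : (y.toMul : F) ≠ 0 := y.toMul.ne_zero
    simp only [toMul_add, mul_inv, Units.val_mul, Units.val_inv_eq_inv_val, Derivation.leibniz,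
      smul_add, smul_smul]
    rw [add_comm]
    congr 2 <;> field_simp

theorem kaehlerMap_smul_D {A : Type u} {B : Type v} [CommRing A] [CommRing B] (f : A →+* B)
    (a b : A) : kaehlerMap f (a • KaehlerDifferential.D ℤ A b) =
      f a • KaehlerDifferential.D ℤ B (f b) := by
  let := f.toAlgebra
  change KaehlerDifferential.map ℤ ℤ A B (a • KaehlerDifferential.D ℤ A b) = _
  rw [map_smul, KaehlerDifferential.map_D, algebra_compatible_smul B a]
  rfl

theorem kaehlerMap_dlog {F : Type u} {E : Type v} [Field F] [Field E] (f : F →+* E)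
    (x : Additive Fˣ) :
    kaehlerMap f (dlog F x) = dlog E (Additive.ofMul (Units.map (f : F →* E) x.toMul)) := by
  simp [dlog, kaehlerMap_smul_D]

/-- The group `Ω¹_{F,log}` of logarithmic differentials of a separably closed field `F`. -/
abbrev LogDifferentials (F : Type u) [Field F] : Type u := (dlog F).range

/-- The homomorphism `Ω¹_{F,log} → Ω¹_{E,log}`, `dlog x ↦ dlog (f x)`, induced by `f`. -/
def LogDifferentials.map {F : Type u} {E : Type v} [Field F] [Field E] (f : F →+* E) :
    LogDifferentials F →+ LogDifferentials E :=
  ((kaehlerMap f).comp (dlog F).range.subtype).codRestrict (dlog E).range (by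
    rintro ⟨_, x, rfl⟩
    exact ⟨_, (kaehlerMap_dlog f x).symm⟩)

theorem LogDifferentials.map_mk {F : Type u} {E : Type v} [Field F] [Field E] (f : F →+* E)
    (x : Additive Fˣ) :
    LogDifferentials.map f ((dlog F).rangeRestrict x) =
      (dlog E).rangeRestrict (Additive.ofMul (Units.map (f : F →* E) x.toMul)) :=
  Subtype.ext (kaehlerMap_dlog f x)

/-- The natural action of the Galois group of `F/k` on `Ω¹_{F,log}`: `σ (dlog x) = dlog (σ x)`. -/
instance LogDifferentials.galoisAction (k : Type u) [Field k] (F : Type v) [Field F]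
    [Algebra k F] : DistribMulAction Gal(F/k) (LogDifferentials F) where
  smul σ := LogDifferentials.map (σ : F →+* F)
  one_smul ω := by
    obtain ⟨x, rfl⟩ := (dlog F).rangeRestrict_surjective ω
    refine (LogDifferentials.map_mk _ x).trans (congrArg _ ?_)
    apply Additive.toMul.injective
    ext
    rfl
  mul_smul σ τ ω := by
    obtain ⟨x, rfl⟩ := (dlog F).rangeRestrict_surjective ω
    change LogDifferentials.map _ _ = LogDifferentials.map _ (LogDifferentials.map _ _)
    rw [LogDifferentials.map_mk, LogDifferentials.map_mk, LogDifferentials.map_mk]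
    refine congrArg _ ?_
    apply Additive.toMul.injective
    ext
    rfl
  smul_zero σ := map_zero (LogDifferentials.map (σ : F →+* F))
  smul_add σ := map_add (LogDifferentials.map (σ : F →+* F))

variable (G : Type u) [Group G] [TopologicalSpace G] (M : Type v) [AddCommGroup M]
  [DistribMulAction G M]

/-- Continuous 1-cocycles of a topological group `G` in a discrete `G`-module `M`. -/
def contCocycles₁ : AddSubgroup (G → M) where
  carrier := {c | IsLocallyConstant c ∧ groupCohomology.IsCocycle₁ c}
  zero_mem' := ⟨IsLocallyConstant.const 0, fun g h => by simp⟩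
  add_mem' := by
    rintro a b ⟨ha, ha'⟩ ⟨hb, hb'⟩
    refine ⟨ha.add hb, fun g h => ?_⟩
    simp only [Pi.add_apply, ha' g h, hb' g h, smul_add]
    abel
  neg_mem' := by
    rintro a ⟨ha, ha'⟩
    refine ⟨ha.neg, fun g h => ?_⟩
    simp only [Pi.neg_apply, ha' g h, smul_neg]
    abel

/-- 1-coboundaries `g ↦ g • x - x` of `G` in `M`. -/
def contCoboundaries₁ : AddSubgroup (G → M) where
  carrier := {c | groupCohomology.IsCoboundary₁ c}
  zero_mem' := ⟨0, fun g => by simp⟩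
  add_mem' := by
    rintro a b ⟨x, hx⟩ ⟨y, hy⟩
    refine ⟨x + y, fun g => ?_⟩
    simp only [Pi.add_apply, ← hx g, ← hy g, smul_add]
    abel
  neg_mem' := by
    rintro a ⟨x, hx⟩
    refine ⟨-x, fun g => ?_⟩
    simp only [Pi.neg_apply, ← hx g, smul_neg]
    abel

/-- The first continuous cohomology group `H¹(G, M)` of a discrete `G`-module `M`. -/
abbrev ContH1 : Type (max u v) :=
  contCocycles₁ G M ⧸ (contCoboundaries₁ G M).addSubgroupOf (contCocycles₁ G M)

/-- The étale cohomology group `H²_ét(k, ℤ/p(1))` of a field `k` of characteristic `p > 0`.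
In characteristic `p` the object `ℤ/p(1)` is the sheaf `Ω¹_log` of logarithmic differentials placed
in degree `1`, so this is `H¹_ét(k, Ω¹_log)`; and étale cohomology of a field is the continuous
cohomology of its absolute Galois group in the stalk at its separable closure, here
`Ω¹_{kˢᵉᵖ,log}` with the discrete topology. -/
abbrev EtaleH2TateTwist (p : ℕ) (k : Type u) [Field k] [CharP k p] : Type u :=
  ContH1 Gal(SeparableClosure k/k) (LogDifferentials (SeparableClosure k))

end Etale

end

noncomputable section


/-! ### Fixed points in finite algebras over a complete Noetherian local ring. -/

section Contraction

open Polynomial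

universe u v

/-! Let `A` be the `R`-subalgebra of `L` generated by the adjoined roots. It is finite over the
complete ring `R`, so equations `x = c + p * g x` are solvable in it. Since a uniformizer and lifts
of a `p`-basis become `p`-th powers, every element of `R` is a `p`-th power modulo `p` in `A`. Hence
each element of `Kˣ` becomes `t ^ p * (1 + p * a)` in `L` (`IsPseudoPerfect.exists_subring`), and
only symbols in such factors `1 + p * a` matter.

The Steinberg relation turns `{1 + pa, 1 + pb}` into `-{1 + p²d, -pa(1 + pb)}` with `d = ab / (1 +
pa)`. For odd `p`, `1 + p²d` is a `p`-th power, so the symbol dies. For `p = 2`, `1 + 4d` need not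
be a square, but `{1 + 4d, 1 + 2c} = 0`; this kills symbols of length at least 3.

For length 2 and `p = 2` what remains is `{1 + 4d, a}`. It vanishes if `a` is, up to a harmless
factor, a value of `x² - xy - dy²`, the norm form attached to `1 + 4d`
(`SteinbergPairing.eq_zero_of_two`). Modulo 2 this reduces to the universality of `m² + mn + γn²`
over the residue field. The latter follows from the vanishing of `H²_ét`: the Artin–Schreier
character of `γ` times `dlog α` is then a coboundary, and this exhibits `α` as a norm
(`exists_norm_of_subsingleton_etaleH2`). -/

theorem mul_mem_smul_top {R : Type u} {A : Type v} [CommRing R] [CommRing A] [Algebra R A]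
    (I : Ideal R) (a : A) {x : A} (hx : x ∈ (I • ⊤ : Submodule R A)) :
    a * x ∈ (I • ⊤ : Submodule R A) := by
  have h : (LinearMap.mulLeft R a) x ∈ (I • ⊤ : Submodule R A).map (LinearMap.mulLeft R a) :=
    Submodule.mem_map_of_mem hx
  rw [Submodule.map_smul''] at h
  exact Submodule.smul_mono le_rfl le_top h

/-- The contraction principle in a finite algebra over a complete Noetherian local ring. -/
theorem exists_eq_add_mul_eval {R : Type u} {A : Type v} [CommRing R] [IsLocalRing R]
    [IsNoetherianRing R] [IsAdicComplete (maximalIdeal R) R] [CommRing A] [Algebra R A]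
    [Module.Finite R A] {t : R} (ht : t ∈ maximalIdeal R) (c : A) (g : A[X]) :
    ∃ x : A, x = c + algebraMap R A t * g.eval x := by
  -- Picard iteration: `x - y` divides `g x - g y`, so each step gains a factor `t`.
  let x : ℕ → A := fun n => Nat.rec c (fun _ y => c + algebraMap R A t * g.eval y) n
  have hx : ∀ n, x (n + 1) = c + algebraMap R A t * g.eval (x n) := fun _ => rfl
  have hd : ∀ n, ∃ d, x (n + 1) - x n = algebraMap R A (t ^ n) * d := by
    intro n
    induction n with
    | zero => exact ⟨x 1 - x 0, by simp⟩
    | succ n ih =>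
      obtain ⟨d, hd⟩ := ih
      obtain ⟨q, hq⟩ := Polynomial.sub_dvd_eval_sub (x (n + 1)) (x n) g
      refine ⟨d * q, ?_⟩
      rw [hx (n + 1)]
      nth_rewrite 2 [hx n]
      rw [map_pow] at hd ⊢
      rw [hd] at hq
      linear_combination algebraMap R A t * hq
  choose d hd using hd
  -- The increments are lifted to a free module `R ^ k`, where the limit is taken coordinatewise.
  obtain ⟨k, f, hf⟩ := Module.Finite.exists_fin' R A
  choose ρ hρ using fun n => hf (d n)
  let s : ℕ → Fin k → R := fun N i => ∑ n ∈ Finset.range N, t ^ n * ρ n i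
  have hs : ∀ N, x N = c + f (s N) := by
    intro N
    induction N with
    | zero =>
      have : s 0 = 0 := by ext i; simp [s]
      simp [this, x]
    | succ N ih =>
      have : s (N + 1) = s N + t ^ N • ρ N := by
        ext i; simp [s, Finset.sum_range_succ]
      rw [this, map_add, map_smul, hρ, Algebra.smul_def, ← add_assoc, ← ih, ← hd]
      ring
  have hmem : ∀ n : ℕ, ∀ r : R, t ^ n * r ∈ maximalIdeal R ^ n := fun n r =>
    Ideal.mul_mem_right _ _ (Ideal.pow_mem_pow ht n)
  have hl : ∀ i, ∃ l : R, ∀ n, s n i ≡ l [SMOD (maximalIdeal R ^ n • ⊤ : Submodule R R)] := by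
    intro i
    refine IsPrecomplete.prec inferInstance ?_
    intro m n hmn
    rw [SModEq.comm, SModEq.sub_mem]
    simp only [smul_eq_mul, Ideal.mul_top, s]
    rw [← Finset.sum_range_add_sum_Ico _ hmn, add_sub_cancel_left]
    refine Ideal.sum_mem _ fun j hj => ?_
    exact Ideal.pow_le_pow_right (Finset.mem_Ico.1 hj).1 (hmem j _)
  choose l hl using hl
  have hlim : ∀ N, c + f l - x N ∈ (maximalIdeal R ^ N • ⊤ : Submodule R A) := by
    intro N
    rw [hs, add_sub_add_left_eq_sub, ← map_sub, LinearMap.pi_apply_eq_sum_univ f]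
    refine Submodule.sum_mem _ fun i _ => Submodule.smul_mem_smul ?_ trivial
    have := (hl i N).symm
    rw [SModEq.sub_mem] at this
    simpa using this
  refine ⟨c + f l, sub_eq_zero.1 (IsHausdorff.haus
    (inferInstance : IsHausdorff (maximalIdeal R) A) _ fun N => ?_)⟩
  rw [SModEq.zero]
  obtain ⟨q, hq⟩ := Polynomial.sub_dvd_eval_sub (c + f l) (x N) g
  have h1 := hlim N
  have h2 : c + f l - x (N + 1) ∈ (maximalIdeal R ^ N • ⊤ : Submodule R A) :=
    Submodule.smul_mono_left (Ideal.pow_le_pow_right N.le_succ) (hlim (N + 1))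
  have h3 := mul_mem_smul_top (maximalIdeal R ^ N) (algebraMap R A t * q) h1
  have := Submodule.sub_mem _ h2 h3
  convert this using 1
  rw [hx]
  linear_combination (- algebraMap R A t) * hq

end Contraction

/-! ### Units and `p`-th roots in contractive rings. -/

section Contractive

open Polynomial

universe u

/-- Every equation `x = c + p * g x` with `g` a polynomial is solvable in `A`. -/
def IsContractive (p : ℕ) (A : Type u) [CommRing A] : Prop :=
  ∀ (c : A) (g : A[X]), ∃ x : A, x = c + (p : A) * g.eval x

variable {p : ℕ} {A : Type u} [CommRing A]

/-- The inverse is the fixed point of `x ↦ 1 - p * y * x`. -/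
theorem IsContractive.isUnit_one_add_mul (h : IsContractive p A) (y : A) :
    IsUnit (1 + (p : A) * y) := by
  obtain ⟨x, hx⟩ := h 1 (C (-y) * X)
  refine IsUnit.of_mul_eq_one x ?_
  simp only [eval_mul, eval_C, eval_X] at hx
  linear_combination hx

theorem IsContractive.isUnit_of_pow_eq (h : IsContractive p A) {a b y : A} {n : ℕ} (hn : n ≠ 0)
    (hb : IsUnit b) (hab : a ^ n = b + (p : A) * y) : IsUnit a := by
  obtain ⟨b, rfl⟩ := hb
  have h1 := (b.isUnit).mul (h.isUnit_one_add_mul (((b⁻¹ : Aˣ) : A) * y))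
  have h2 : a ^ n = b * (1 + (p : A) * (((b⁻¹ : Aˣ) : A) * y)) := by
    rw [hab]
    linear_combination (- (p : A) * y) * b.mul_inv
  rw [← h2] at h1
  exact (isUnit_pow_iff hn).1 h1

theorem IsContractive.isUnit_one_add_of_pow_mem (h : IsContractive p A) {a y : A} {n : ℕ}
    (ha : a ^ n = (p : A) * y) : IsUnit (1 + a) := by
  have h1 : (1 + a) ∣ 1 + (p : A) * (- ((-1) ^ n * y)) := by
    have : (1 : A) - (-a) ∣ 1 ^ n - (-a) ^ n := sub_dvd_pow_sub_pow _ _ _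
    convert this using 1
    · ring
    · rw [neg_pow a, ha]; ring
  exact isUnit_of_dvd_unit h1 (h.isUnit_one_add_mul _)

theorem exists_one_add_pow_eq (A : Type u) [CommRing A] (n : ℕ) :
    ∃ s : A[X], (1 + X) ^ n = 1 + (n : A[X]) * X + (n.choose 2 : A[X]) * X ^ 2 + X ^ 3 * s := by
  induction n with
  | zero => exact ⟨0, by simp⟩
  | succ n ih =>
    obtain ⟨s, hs⟩ := ih
    refine ⟨s * (1 + X) + (n.choose 2 : A[X]), ?_⟩
    rw [pow_succ, hs, Nat.choose_succ_succ' n 1]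
    push_cast [Nat.choose_one_right]
    ring

/-- For odd `p`, `p` divides `p.choose 2`, so `(1 + p * x) ^ p = 1 + p ^ 2 * (x + p * (…))` and the
bracket can be made equal to `c` by contraction. For `p = 2` the quadratic term is too large. -/
theorem IsContractive.exists_pow_eq_one_add_sq_mul (h : IsContractive p A) (hp : Odd p) (c : A) :
    ∃ x : A, x ^ p = 1 + (p : A) ^ 2 * c := by
  obtain ⟨s, hs⟩ := exists_one_add_pow_eq A p
  obtain ⟨m, hm⟩ := hp
  have hch : p.choose 2 = p * m := by
    rw [Nat.choose_two_right, hm, Nat.add_sub_cancel]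
    exact Nat.div_eq_of_eq_mul_left two_pos (by ring)
  rw [hch] at hs
  obtain ⟨x, hx⟩ := h c (-((m : A[X]) * X ^ 2 + X ^ 3 * s.comp ((p : A[X]) * X)))
  refine ⟨1 + (p : A) * x, ?_⟩
  have := congrArg (eval ((p : A) * x)) hs
  simp only [eval_pow, eval_add, eval_one, eval_X, eval_mul, eval_natCast, eval_neg,
    eval_comp] at this hx
  push_cast at this
  rw [this]
  linear_combination (p : A) ^ 2 * hx

/-- As `(1 + 2x)² = 1 + 4(x² + x)`, the task is to solve `x² + x = μ`. Modulo 2 a solution is `μ +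
μ² + μ⁴ + …`, a finite sum because `μ` is nilpotent there; contraction then corrects it by a
multiple of 2. -/
theorem IsContractive.exists_sq_eq_one_add_four_mul (h : IsContractive 2 A) {μ y : A} {n : ℕ}
    (hμ : μ ^ n = 2 * y) : ∃ x : A, x ^ 2 = 1 + 4 * μ := by
  -- Here `x₀` is the sum of the first `k` terms `μ ^ 2 ^ j`; squaring modulo 2 makes it telescope.
  have key : ∀ k : ℕ, ∃ x₀ z : A, x₀ ^ 2 + x₀ = μ + μ ^ 2 ^ k + 2 * z := by
    intro k
    induction k with
    | zero => exact ⟨0, -μ, by ring⟩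
    | succ k ih =>
      obtain ⟨x₀, z, hz⟩ := ih
      refine ⟨x₀ + μ ^ 2 ^ k, z + x₀ * μ ^ 2 ^ k + μ ^ 2 ^ k, ?_⟩
      rw [pow_succ 2 k, pow_mul]
      linear_combination hz
  obtain ⟨x₀, z, hz⟩ := key n
  have h2 : μ ^ 2 ^ n = 2 * (y * μ ^ (2 ^ n - n)) := by
    rw [← mul_assoc, ← hμ, ← pow_add, Nat.add_sub_cancel' n.lt_two_pow_self.le]
  obtain ⟨w, hw⟩ := h (-(y * μ ^ (2 ^ n - n) + z)) (-(X ^ 2 + C x₀ * X))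
  refine ⟨1 + 2 * (x₀ + 2 * w), ?_⟩
  simp only [eval_neg, eval_add, eval_pow, eval_mul, eval_C, eval_X] at hw
  push_cast at hw
  linear_combination 4 * hz + 4 * h2 + 8 * hw

end Contractive

/-! ### The `p`-power map modulo `p`. -/

section FrobeniusLift

universe u v

variable (p : ℕ) [hp : Fact p.Prime] (R : Type v) (A : Type u) [CommRing R] [CommRing A]
  [Algebra R A]

/-- The subring of elements that are `p`-th powers modulo `p`. -/
def powModSubring : Subring A where
  carrier := {x | ∃ a y : A, x = a ^ p + p * y}
  one_mem' := ⟨1, 0, by simp⟩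
  zero_mem' := ⟨0, 0, by simp [hp.out.ne_zero]⟩
  mul_mem' := by
    rintro _ _ ⟨a, y, rfl⟩ ⟨b, z, rfl⟩
    exact ⟨a * b, a ^ p * z + y * b ^ p + p * y * z, by ring⟩
  add_mem' := by
    rintro _ _ ⟨a, y, rfl⟩ ⟨b, z, rfl⟩
    obtain ⟨r, hr⟩ := exists_add_pow_prime_eq hp.out a b
    exact ⟨a + b, y + z - a * b * r, by rw [hr]; ring⟩
  neg_mem' := by
    rintro _ ⟨a, y, rfl⟩
    obtain ⟨r, hr⟩ := exists_add_pow_prime_eq hp.out a (-a)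
    rw [add_neg_cancel, zero_pow hp.out.ne_zero] at hr
    exact ⟨-a, -y - a * a * r, by linear_combination hr⟩

/-- The subalgebra of elements whose `p`-th power lies in `R` modulo `p`. -/
def powMemSubalgebra : Subalgebra R A where
  carrier := {a | ∃ (r : R) (y : A), a ^ p = algebraMap R A r + p * y}
  mul_mem' := by
    rintro a b ⟨r, y, hy⟩ ⟨s, z, hz⟩
    exact ⟨r * s, algebraMap R A r * z + y * algebraMap R A s + p * y * z, by
      rw [mul_pow, hy, hz, map_mul]; ring⟩
  add_mem' := by
    rintro a b ⟨r, y, hy⟩ ⟨s, z, hz⟩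
    obtain ⟨q, hq⟩ := exists_add_pow_prime_eq hp.out a b
    exact ⟨r + s, y + z + a * b * q, by rw [hq, hy, hz, map_add]; ring⟩
  algebraMap_mem' r := ⟨r ^ p, 0, by simp⟩

end FrobeniusLift

section PBasis

universe u v

variable {p : ℕ} [hp : Fact p.Prime] {R : Type v} {A : Type u} [CommRing R] [IsDomain R]
  [IsDiscreteValuationRing R] [CharP (ResidueField R) p] [CommRing A] [Algebra R A]

/-- The elements of `R` in question form a subring `S` containing all `p`-th powers, the lifts of
the `p`-basis and `ϖ`. The first two kinds make `S` surject onto the residue field, and `ϖ`-adic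
expansion finishes. -/
theorem algebraMap_mem_powModSubring (hp0 : (p : R) ≠ 0) {B : Finset (ResidueField R)}
    (hB : IsFinitePBasis p B) {lift : B → R} (hlift : ∀ b, residue R (lift b) = b) {ϖ : R}
    (hϖ : Irreducible ϖ) {v : B → A} (hv : ∀ b, v b ^ p = algebraMap R A (lift b)) {z : A}
    (hz : z ^ p = algebraMap R A ϖ) (r : R) : algebraMap R A r ∈ powModSubring p A := by
  set S := (powModSubring p A).comap (algebraMap R A) with hS
  have hpow : ∀ r : R, r ^ p ∈ S := fun r => ⟨algebraMap R A r, 0, by simp⟩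
  have hlift_mem : ∀ b, lift b ∈ S := fun b => ⟨v b, 0, by simp [hv]⟩
  have hϖ_mem : ϖ ∈ S := ⟨z, 0, by simp [hz]⟩
  have h1 : ∀ x : ResidueField R, x ∈ S.map (residue R) := by
    intro x
    have hx : x ∈ Submodule.span (frobenius (ResidueField R) p).fieldRange
      (Set.range fun s : B → Fin p => ∏ b : B, (b : ResidueField R) ^ (s b : ℕ)) := by
      rw [hB.2]; trivial
    induction hx using Submodule.span_induction with
    | mem x hx =>
      obtain ⟨s, rfl⟩ := hx
      refine Subring.prod_mem _ fun b _ => Subring.pow_mem _ ?_ _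
      exact ⟨lift b, hlift_mem b, hlift b⟩
    | zero => exact Subring.zero_mem _
    | add x y _ _ hx hy => exact Subring.add_mem _ hx hy
    | smul c x _ hx =>
      obtain ⟨_, y, rfl⟩ := c
      obtain ⟨y, rfl⟩ := residue_surjective y
      refine Subring.mul_mem _ ⟨y ^ p, hpow y, ?_⟩ hx
      simp [frobenius_def]
  have h2 : ∀ k : ℕ, ∀ r : R, ∃ s ∈ S, ∃ r', r = s + ϖ ^ k * r' := by
    intro k
    induction k with
    | zero => exact fun r => ⟨0, S.zero_mem, r, by simp⟩
    | succ k ih =>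
      intro r
      obtain ⟨s, hs, r', hr'⟩ := ih r
      obtain ⟨s', hs', h⟩ := h1 (residue R r')
      have h3 : r' - s' ∈ maximalIdeal R := by
        rw [← residue_eq_zero_iff, map_sub, h, sub_self]
      rw [hϖ.maximalIdeal_eq, Ideal.mem_span_singleton] at h3
      obtain ⟨q, hq⟩ := h3
      refine ⟨s + ϖ ^ k * s', S.add_mem hs (S.mul_mem (S.pow_mem hϖ_mem k) hs'), q, ?_⟩
      rw [hr', ← sub_add_cancel r' s', hq]
      ring
  -- Finitely many digits suffice: `p` is associated to `ϖ ^ n`, so the remainder is a multiple of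
  -- `p`, congruent to `0 ^ p`.
  obtain ⟨n, hn⟩ := IsDiscreteValuationRing.associated_pow_irreducible hp0 hϖ
  obtain ⟨u, hu⟩ := hn
  obtain ⟨s, hs, r', hr'⟩ := h2 n r
  have hpm : ϖ ^ n * r' ∈ S := by
    refine ⟨0, algebraMap R A (u * r'), ?_⟩
    rw [← hu]
    simp [hp.out.ne_zero, mul_assoc]
  rw [hr']
  exact S.add_mem hs hpm

end PBasis


/-! ### Formal consequences of the Steinberg relation. -/

section Pairing

universe u v

/-- A bimultiplicative pairing on `Fˣ` which satisfies the Steinberg relation. -/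
structure SteinbergPairing (F : Type u) [Field F] (M : Type v) [AddCommGroup M] where
  toFun : Fˣ → Fˣ → M
  mul_left : ∀ a b c, toFun (a * b) c = toFun a c + toFun b c
  mul_right : ∀ a b c, toFun a (b * c) = toFun a b + toFun a c
  steinberg : ∀ a b : Fˣ, (a : F) + b = 1 → toFun a b = 0

namespace SteinbergPairing

variable {F : Type u} [Field F] {M : Type v} [AddCommGroup M] (β : SteinbergPairing F M)

theorem one_left (a : Fˣ) : β.toFun 1 a = 0 := by simpa using β.mul_left 1 1 a

theorem one_right (a : Fˣ) : β.toFun a 1 = 0 := by simpa using β.mul_right a 1 1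

theorem inv_left (a b : Fˣ) : β.toFun a⁻¹ b = -β.toFun a b := by
  rw [eq_neg_iff_add_eq_zero, ← β.mul_left, inv_mul_cancel, one_left]

theorem inv_right (a b : Fˣ) : β.toFun a b⁻¹ = -β.toFun a b := by
  rw [eq_neg_iff_add_eq_zero, ← β.mul_right, inv_mul_cancel, one_right]

theorem pow_left (a b : Fˣ) (n : ℕ) : β.toFun (a ^ n) b = n • β.toFun a b := by
  induction n with
  | zero => simp [one_left]
  | succ n ih => rw [pow_succ, mul_left, ih, succ_nsmul]

theorem pow_right (a b : Fˣ) (n : ℕ) : β.toFun a (b ^ n) = n • β.toFun a b := by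
  induction n with
  | zero => simp [one_right]
  | succ n ih => rw [pow_succ, mul_right, ih, succ_nsmul]

/-- The classical identity `-a = (1 - a) / (1 - a⁻¹)`. -/
theorem self_neg (a : Fˣ) : β.toFun a (-a) = 0 := by
  by_cases h : a = 1
  · rw [h, one_left]
  have h1 : (1 : F) - a ≠ 0 := fun h' => h (Units.ext (sub_eq_zero.1 h').symm)
  have h2 : (1 : F) - (a⁻¹ : Fˣ) ≠ 0 := fun h' =>
    h (inv_eq_one.1 (Units.ext (sub_eq_zero.1 h').symm))
  have h3 : -a = Units.mk0 _ h1 * (Units.mk0 _ h2)⁻¹ := by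
    rw [eq_mul_inv_iff_mul_eq]
    ext
    have := a.ne_zero
    simp only [Units.val_mul, Units.val_neg, Units.val_mk0, Units.val_inv_eq_inv_val]
    field_simp
    ring
  rw [h3, mul_right, inv_right, ← inv_left, β.steinberg a _ (by simp),
    β.steinberg a⁻¹ _ (by simp), add_zero]

/-- The product formula `{1 + x, 1 + y} = -{1 + xy / (1 + x), -x (1 + y)}`. -/
theorem eq_neg_of_mul_eq (a b w m : Fˣ) (hm : (m : F) = (1 - a) * b) (hw : (w : F) * a = 1 - m) :
    β.toFun a b = -β.toFun w m := by
  -- `{w * a, m} = 0`, while `{a, m} = {a, b}` because `m = (1 - a) * b` and `{a, 1 - a} = 0`.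
  have h1 := β.steinberg (w * a) m (by rw [Units.val_mul, hw]; ring)
  have h2 : (1 : F) - a ≠ 0 := by
    intro h
    apply m.ne_zero
    rw [hm, h, zero_mul]
  have h3 : m = Units.mk0 _ h2 * b := by ext; simp [hm]
  have h4 := β.steinberg a (Units.mk0 _ h2) (by simp)
  rw [mul_left] at h1
  rw [eq_neg_iff_add_eq_zero, ← h1, add_comm]
  congr 1
  rw [h3, mul_right, h4, zero_add]

/-- The vanishing criterion used below: the first entry in the product formula is an `n`-th power.
-/
theorem eq_zero_of_pow_mul_eq {n : ℕ} (hM : ∀ x : M, n • x = 0) (a b x : Fˣ)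
    (h : (x : F) ^ n * a = 1 - (1 - a) * b) : β.toFun a b = 0 := by
  by_cases ha : (1 : F) - a = 0
  · rw [show a = 1 from Units.ext (sub_eq_zero.1 ha).symm, one_left]
  rw [β.eq_neg_of_mul_eq a b (x ^ n) (Units.mk0 _ ha * b) (by simp) (by simpa using h), pow_left,
    hM, neg_zero]

/-- Dividing by `x²` gives the Steinberg pair `D(y/x)² + q/x² = 1`; the degenerate case `x = 0` is
`{D, -D} = 0` up to squares. -/
theorem eq_zero_of_sq_sub_mul_sq (hM : ∀ x : M, 2 • x = 0) (D q : Fˣ) (x y : F)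
    (h : (q : F) = x ^ 2 - D * y ^ 2) : β.toFun D q = 0 := by
  by_cases hy : y = 0
  · have hx : x ≠ 0 := by
      rintro rfl
      exact q.ne_zero (by rw [h, hy]; ring)
    have : q = Units.mk0 x hx ^ 2 := by ext; simp [h, hy]
    rw [this, pow_right, hM]
  by_cases hx : x = 0
  · have : q = -D * Units.mk0 y hy ^ 2 := by ext; simp [h, hx]
    rw [this, mul_right, pow_right, hM, self_neg, add_zero]
  · have := β.steinberg (D * (Units.mk0 y hy * (Units.mk0 x hx)⁻¹) ^ 2)
      (q * ((Units.mk0 x hx)⁻¹) ^ 2) (by simp [h]; field_simp; ring)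
    rw [mul_left, pow_left, hM, mul_right, pow_right, hM, add_zero, add_zero] at this
    exact this

end SteinbergPairing

end Pairing

/-! ### Symbols with entries congruent to 1 modulo `p`. -/

section PairingIntegral

universe u v w w'

variable {A : Type u} [CommRing A] {F : Type v} [Field F] [Algebra A F] {M : Type w}
  [AddCommGroup M] (β : SteinbergPairing F M)

namespace SteinbergPairing

theorem eq_zero_of_odd {p : ℕ} (hp : Odd p) (hA : IsContractive p A) (hM : ∀ x : M, p • x = 0)
    (u v : Fˣ) (a b : A) (hu : (u : F) = algebraMap A F (1 + p * a))
    (hv : (v : F) = algebraMap A F (1 + p * b)) : β.toFun u v = 0 := by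
  obtain ⟨i, hi⟩ := (hA.isUnit_one_add_mul a).exists_right_inv
  obtain ⟨x, hx⟩ := hA.exists_pow_eq_one_add_sq_mul hp (a * b * i)
  have hxu : IsUnit x := by
    rw [← isUnit_pow_iff hp.pos.ne', hx, pow_two, mul_assoc]
    exact hA.isUnit_one_add_mul _
  refine β.eq_zero_of_pow_mul_eq hM u v (hxu.map (algebraMap A F)).unit ?_
  rw [IsUnit.unit_spec, hu, hv, ← map_pow, ← map_mul, ← map_one (algebraMap A F), ← map_sub,
    ← map_mul, ← map_sub, hx]
  congr 1
  linear_combination (p : A) ^ 2 * a * b * hi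

variable (hA : IsContractive 2 A)

include hA

theorem exists_pairing_eq_neg (u v : Fˣ) (a b : A) (hu : (u : F) = algebraMap A F (1 + 2 * a))
    (hv : (v : F) = algebraMap A F (1 + 2 * b)) (hu1 : u ≠ 1) :
    ∃ (d : A) (w m : Fˣ), d * (1 + 2 * a) = a * b ∧ (w : F) = algebraMap A F (1 + 4 * d) ∧
      (m : F) = algebraMap A F (-2 * a * (1 + 2 * b)) ∧
      ∀ {N : Type w'} [AddCommGroup N] (β : SteinbergPairing F N),
        β.toFun u v = -β.toFun w m := by
  obtain ⟨i, hi⟩ := (hA.isUnit_one_add_mul a).exists_right_inv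
  have h1 : (1 : F) - u ≠ 0 := fun h => hu1 (Units.ext (sub_eq_zero.1 h).symm)
  have hw : IsUnit (1 + 4 * (a * b * i)) := by
    convert hA.isUnit_one_add_mul (2 * (a * b * i)) using 1
    push_cast
    ring
  push_cast at hi
  refine ⟨a * b * i, (hw.map (algebraMap A F)).unit, Units.mk0 _ h1 * v, ?_, rfl, ?_, ?_⟩
  · linear_combination a * b * hi
  · rw [Units.val_mul, Units.val_mk0, hu, hv, ← map_one (algebraMap A F), ← map_sub, ← map_mul]
    congr 1
    ring
  · intro N _ β
    refine β.eq_neg_of_mul_eq _ _ _ _ rfl ?_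
    rw [IsUnit.unit_spec, Units.val_mul, Units.val_mk0, hu, hv, ← map_one (algebraMap A F),
      ← map_sub, ← map_mul, ← map_mul, ← map_sub]
    congr 1
    linear_combination 4 * a * b * hi

/-- The product formula yields the first entry `1 + 4dμ / (1 + 4d)`, which is a square since `dμ /
(1 + 4d)` inherits nilpotence modulo 2 from `μ`. -/
theorem eq_zero_of_four_mul (hM : ∀ x : M, 2 • x = 0) (u v : Fˣ) (d μ y : A) (n : ℕ)
    (hμ : μ ^ n = 2 * y) (hu : (u : F) = algebraMap A F (1 + 4 * d))
    (hv : (v : F) = algebraMap A F (1 + μ)) : β.toFun u v = 0 := by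
  have hd : IsUnit (1 + 4 * d) := by
    convert hA.isUnit_one_add_mul (2 * d) using 1
    push_cast
    ring
  obtain ⟨i, hi⟩ := hd.exists_right_inv
  obtain ⟨x, hx⟩ := hA.exists_sq_eq_one_add_four_mul (μ := d * μ * i) (n := n)
    (y := (d * i) ^ n * y) (by rw [mul_right_comm, mul_pow, hμ]; ring)
  have hxu : IsUnit x := by
    rw [← isUnit_pow_iff two_ne_zero, hx]
    convert hA.isUnit_one_add_mul (2 * (d * μ * i)) using 1
    push_cast
    ring
  refine β.eq_zero_of_pow_mul_eq hM u v (hxu.map (algebraMap A F)).unit ?_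
  rw [IsUnit.unit_spec, hu, hv, ← map_pow, ← map_mul, ← map_one (algebraMap A F), ← map_sub,
    ← map_mul, ← map_sub, hx]
  congr 1
  linear_combination 4 * d * μ * hi

theorem eq_zero_of_four_mul_of_pow (hM : ∀ x : M, 2 • x = 0) (u v : Fˣ) (d y : A) (n : ℕ)
    (hd : d ^ n = 2 * y) (hu : (u : F) = algebraMap A F (1 + 4 * d)) : β.toFun u v = 0 := by
  obtain ⟨x, hx⟩ := hA.exists_sq_eq_one_add_four_mul hd
  have hx0 : algebraMap A F x ≠ 0 := by
    intro h
    apply u.ne_zero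
    rw [hu, ← hx, map_pow, h]
    ring
  have : u = Units.mk0 _ hx0 ^ 2 := by ext; simp [hu, ← hx]
  rw [this, pow_left, hM]

omit hA in
-- `4(x² - xy - dy²) = (2x - y)² - (1 + 4d)y²`.
theorem eq_zero_of_norm (hM : ∀ x : M, 2 • x = 0) (u v : Fˣ) (d x y : A)
    (hu : (u : F) = algebraMap A F (1 + 4 * d))
    (hv : (v : F) = algebraMap A F (x ^ 2 - x * y - d * y ^ 2)) : β.toFun u v = 0 := by
  by_cases h2 : (2 : F) = 0
  · have : u = 1 := by
      ext
      rw [hu, map_add, map_mul, map_ofNat, show (4 : F) = 2 * 2 by norm_num]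
      simp [h2]
    rw [this, one_left]
  have key := β.eq_zero_of_sq_sub_mul_sq hM u (v * Units.mk0 2 h2 ^ 2)
    (algebraMap A F (2 * x - y)) (algebraMap A F y) (by
      rw [Units.val_mul, hv, hu]
      simp only [Units.val_pow_eq_pow_val, Units.val_mk0, map_sub, map_add, map_mul, map_pow,
        map_one, map_ofNat]
      ring)
  rwa [mul_right, pow_right, hM, add_zero] at key

end SteinbergPairing

end PairingIntegral

/-! ### Length-two symbols for `p = 2` via norm forms. -/

section NormForm

universe u v w w'

theorem exists_pow_eq_two_mul_of_sq_eq {A : Type u} [CommRing A] {a t q y : A} {k : ℕ}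
    (h : a ^ 2 = t + 2 * q) (ht : t ^ k = 2 * y) : ∃ y', a ^ (2 * k) = 2 * y' := by
  obtain ⟨c, hc⟩ : (t + 2 * q) - t ∣ (t + 2 * q) ^ k - t ^ k := sub_dvd_pow_sub_pow _ _ _
  refine ⟨y + q * c, ?_⟩
  rw [pow_mul, h]
  linear_combination hc + ht

variable {R : Type u} {A : Type v} [CommRing R] [IsLocalRing R] [CommRing A] [Algebra R A]
  (hrad : ∀ t ∈ maximalIdeal R, ∃ (n : ℕ) (y : A), algebraMap R A t ^ n = 2 * y)
  (happrox : ∀ r : R, ∃ a y : A, algebraMap R A r = a ^ 2 + 2 * y)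
  (hpow : ∀ a : A, ∃ (r : R) (y : A), a ^ 2 = algebraMap R A r + 2 * y)
  (hnorm : ∀ γ α : ResidueField R, ∃ m n, α = m ^ 2 + m * n + γ * n ^ 2)

include hrad happrox hpow hnorm in
-- Compare squares modulo 2: `a²` and `d²` come from `r`, `s` in `R`, and `hnorm` writes `r` as `m²
-- + mn + sn²` modulo the maximal ideal. If `m`, `n` are `x²`, `y²` modulo 2, that value is `(x² -
-- xy - dy²)²` modulo 2, so the error `μ` has a square that is nilpotent modulo 2.
theorem exists_eq_norm_add (a d : A) :
    ∃ (x y μ z : A) (n : ℕ), a = x ^ 2 - x * y - d * y ^ 2 + μ ∧ μ ^ n = 2 * z := by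
  obtain ⟨r, y₁, h₁⟩ := hpow a
  obtain ⟨s, y₂, h₂⟩ := hpow d
  obtain ⟨m, n, hmn⟩ := hnorm (residue R s) (residue R r)
  obtain ⟨m, rfl⟩ := residue_surjective m
  obtain ⟨n, rfl⟩ := residue_surjective n
  obtain ⟨x, y₃, h₃⟩ := happrox m
  obtain ⟨y, y₄, h₄⟩ := happrox n
  obtain ⟨k, z, hz⟩ := hrad (r - (m ^ 2 + m * n + s * n ^ 2)) (by
    rw [← residue_eq_zero_iff, map_sub, hmn]
    simp)
  obtain ⟨z', hz'⟩ := exists_pow_eq_two_mul_of_sq_eq (a := a - (x ^ 2 - x * y - d * y ^ 2))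
    -- `q` is the quotient by 2 in this congruence of squares.
    (q := y₁ - a * (x ^ 2 - x * y - d * y ^ 2) + (x ^ 4 - x ^ 3 * y - d * x ^ 2 * y ^ 2
      + d * x * y ^ 3) + x ^ 2 * y ^ 2 + 2 * x ^ 2 * y₃ + 2 * y₃ ^ 2 + x ^ 2 * y₄ + y₃ * y ^ 2
      + 2 * y₃ * y₄ + algebraMap R A s * (y ^ 4 + 2 * y ^ 2 * y₄ + 2 * y₄ ^ 2) + y₂ * y ^ 4) (by
    simp only [map_sub, map_add, map_mul, map_pow, h₃, h₄]
    linear_combination h₁ + y ^ 4 * h₂) hz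
  exact ⟨x, y, _, z', _, by ring, hz'⟩

variable {F : Type w} [Field F] [Algebra A F] {M : Type w'} [AddCommGroup M]
  (β : SteinbergPairing F M)

include hrad happrox hpow hnorm in
theorem SteinbergPairing.eq_zero_of_two (hA : IsContractive 2 A) (hM : ∀ x : M, 2 • x = 0)
    (h2 : ∃ (t s : Fˣ) (z : A), (t ^ 2 * s : F) = 2 ∧ (s : F) = algebraMap A F (1 + 2 * z))
    (u v : Fˣ) (a b : A) (hu : (u : F) = algebraMap A F (1 + 2 * a))
    (hv : (v : F) = algebraMap A F (1 + 2 * b)) : β.toFun u v = 0 := by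
  by_cases hu1 : u = 1
  · rw [hu1, one_left]
  obtain ⟨d, w, m, hd, hw, hm, h⟩ := exists_pairing_eq_neg hA u v a b hu hv hu1
  rw [h, neg_eq_zero]
  have hone : ∀ (z : A) (s : Fˣ), (s : F) = algebraMap A F (1 + 2 * z) → β.toFun w s = 0 :=
    fun z s hs => β.eq_zero_of_four_mul hA hM w s d (2 * z) z 1 (by ring) hw hs
  obtain ⟨t, s, z, hts, hs⟩ := h2
  have ha0 : algebraMap A F a ≠ 0 := by
    intro h
    apply m.ne_zero
    rw [hm]
    simp [h]
  -- Of the factors of `m = -2 * a * v`, both `-1 = 1 + 2 * (-1)` and `v` pair trivially with `w`,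
  -- as does `2 = t ^ 2 * s`. Only `a` is left.
  have hm' : m = -1 * (t ^ 2 * s) * Units.mk0 _ ha0 * v := by
    ext
    simp only [Units.val_mul, hm, hts, Units.val_pow_eq_pow_val, Units.val_neg, Units.val_one,
      Units.val_mk0, hv, map_mul, map_neg, map_ofNat]
    ring
  rw [hm', mul_right, mul_right, mul_right, mul_right, pow_right, hM, hone z s hs, hone b v hv,
    hone (-1) (-1) (by rw [show (1 + 2 * (-1) : A) = -1 by norm_num]; simp), add_zero, add_zero,
    zero_add, zero_add]
  obtain ⟨r, y, hr⟩ := hpow a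
  by_cases hru : IsUnit r
  · have hau : IsUnit a := hA.isUnit_of_pow_eq two_ne_zero (hru.map (algebraMap R A))
      (by simpa using hr)
    obtain ⟨i, hi⟩ := hau.exists_right_inv
    obtain ⟨x, y, μ, z, n, haμ, hμ⟩ := exists_eq_norm_add hrad happrox hpow hnorm a d
    have hμi : (-(μ * i)) ^ n = 2 * (z * (-i) ^ n) := by
      rw [← mul_neg, mul_pow, hμ]; ring
    have h1 : IsUnit (1 + -(μ * i)) := hA.isUnit_one_add_of_pow_mem (by exact_mod_cast hμi)
    -- The norm differs from `a` by the factor `1 - μ / a`, which `eq_zero_of_four_mul` disposes of.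
    have hq : x ^ 2 - x * y - d * y ^ 2 = a * (1 + -(μ * i)) := by
      linear_combination -haμ + μ * hi
    have h3 := β.eq_zero_of_norm hM w ((hau.mul h1).map (algebraMap A F)).unit d x y hw
      (by rw [IsUnit.unit_spec, hq])
    have h4 : ((hau.mul h1).map (algebraMap A F)).unit =
        Units.mk0 _ ha0 * (h1.map (algebraMap A F)).unit := by
      ext; simp
    rwa [h4, mul_right, β.eq_zero_of_four_mul hA hM w _ d _ _ n hμi hw (IsUnit.unit_spec _),
      add_zero] at h3
  -- Now `a` is nilpotent modulo 2, hence so is its multiple `d`, and `1 + 4d` is itself a square.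
  · obtain ⟨k, z, hz⟩ := hrad r hru
    obtain ⟨y', hy'⟩ := exists_pow_eq_two_mul_of_sq_eq hr hz
    obtain ⟨i, hi⟩ := (hA.isUnit_one_add_mul a).exists_right_inv
    push_cast at hi
    have hd' : d = a * (b * i) := by linear_combination i * hd - d * hi
    exact β.eq_zero_of_four_mul_of_pow hA hM w _ d (y' * (b * i) ^ (2 * k)) (2 * k)
      (by rw [hd', mul_pow, hy']; ring) hw

end NormForm


/-! ### `p`-bases, their derivations and the kernel of `dlog`. -/

section PBasisFamily

universe u v w

/-- The monomial `∏ b, v b ^ s b`. -/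
def pMonomial {p : ℕ} {k : Type u} [Field k] {ι : Type w} [Fintype ι] (v : ι → k)
    (s : ι → Fin p) : k :=
  ∏ b, v b ^ (s b : ℕ)

/-- Every element is uniquely a combination of the monomials `∏ b, v b ^ s b`, `0 ≤ s b < p`,
with `p`-th powers as coefficients. -/
def IsPBasisFamily (p : ℕ) {k : Type u} [Field k] {ι : Type w} [Fintype ι] [DecidableEq ι]
    (v : ι → k) : Prop :=
  (∀ x, ∃ r : (ι → Fin p) → k, x = ∑ s, r s ^ p * pMonomial v s) ∧
    ∀ r : (ι → Fin p) → k, ∑ s, r s ^ p * pMonomial v s = 0 → ∀ s, r s = 0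

variable {p : ℕ} [hp : Fact p.Prime]

theorem IsFinitePBasis.isPBasisFamily {k : Type u} [Field k] [CharP k p] {B : Finset k}
    [DecidableEq B] (hB : IsFinitePBasis p B) : IsPBasisFamily p (fun b : B => (b : k)) := by
  refine ⟨fun x => ?_, fun r hr => ?_⟩
  · have hx : x ∈ Submodule.span (frobenius k p).fieldRange
      (Set.range fun s : B → Fin p => ∏ b : B, (b : k) ^ (s b : ℕ)) := by
      rw [hB.2]; trivial
    obtain ⟨c, rfl⟩ := (Submodule.mem_span_range_iff_exists_fun _).1 hx
    choose r hr using fun s => (c s).2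
    refine ⟨r, Finset.sum_congr rfl fun s _ => ?_⟩
    rw [Subfield.smul_def, smul_eq_mul, ← hr, frobenius_def, pMonomial]
  · have h := Fintype.linearIndependent_iff.1 hB.1 (fun s => ⟨r s ^ p, r s, rfl⟩) hr
    intro s
    exact eq_zero_of_pow_eq_zero (congrArg Subtype.val (h s))

namespace IsPBasisFamily

section Separable

variable {k : Type u} [Field k] [CharP k p] {E : Type v} [Field E] [Algebra k E]
  {ι : Type w} [Fintype ι] [DecidableEq ι] {v : ι → k}

omit hp [CharP k p] [DecidableEq ι] in
theorem map_pMonomial (s : ι → Fin p) :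
    algebraMap k E (pMonomial v s) = pMonomial (fun b => algebraMap k E (v b)) s := by
  simp [pMonomial]

omit hp [CharP k p] in
-- By separability the `p`-th powers of a basis of `E / k` again form a basis, and Frobenius expands
-- `x ^ p` in it. This lets a relation over `E` be read off coordinatewise over `k`.
theorem repr_pow_mul [ExpChar k p] [Algebra.IsSeparable k E] {κ : Type v} (b : Module.Basis κ k E)
    (x : E) (a : k) (i : κ) :
    (b.mapPowExpCharPowOfIsSeparable p 1).repr (x ^ p * algebraMap k E a) i =
      b.repr x i ^ p * a := by
  have : ExpChar E p := expChar_of_injective_algebraMap (algebraMap k E).injective p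
  set b' := b.mapPowExpCharPowOfIsSeparable p 1
  have hb' : ∀ i, b' i = b i ^ p := fun i => by
    simp [b', Module.Basis.mapPowExpCharPowOfIsSeparable]
  have h : x ^ p = ∑ j ∈ (b.repr x).support, (b.repr x j ^ p) • b' j := by
    conv_lhs => rw [← b.linearCombination_repr x, Finsupp.linearCombination_apply, Finsupp.sum]
    rw [← frobenius_def, map_sum]
    refine Finset.sum_congr rfl fun j _ => ?_
    rw [frobenius_def, hb', Algebra.smul_def, Algebra.smul_def, mul_pow, map_pow]
  rw [mul_comm, ← Algebra.smul_def, map_smul, Finsupp.smul_apply, smul_eq_mul, mul_comm, h]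
  congr 1
  simp only [map_sum, map_smul, Module.Basis.repr_self, Finsupp.coe_finsetSum, Finset.sum_apply,
    Finsupp.smul_apply, smul_eq_mul]
  classical
  simp only [Finsupp.single_apply, mul_ite, mul_one, mul_zero, Finset.sum_ite_eq',
    Finsupp.mem_support_iff]
  split_ifs with h0
  · rfl
  · rw [not_not.1 h0, zero_pow (expChar_pos k p).ne']

/-- A `p`-basis remains a `p`-basis in a separable algebraic extension. -/
theorem map [Algebra.IsSeparable k E] (hv : IsPBasisFamily p v) :
    IsPBasisFamily p (fun b => algebraMap k E (v b)) := by
  have : ExpChar E p := expChar_of_injective_algebraMap (algebraMap k E).injective p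
  obtain ⟨h1, h2⟩ := hv
  let b := Module.Basis.ofVectorSpace k E
  let b' := b.mapPowExpCharPowOfIsSeparable p 1
  have hb' : ∀ i, b' i = b i ^ p := fun i => by
    simp [b', Module.Basis.mapPowExpCharPowOfIsSeparable]
  refine ⟨fun x => ?_, fun r hr s => ?_⟩
  · let T : AddSubmonoid E :=
      { carrier := {x | ∃ r : (ι → Fin p) → E,
          x = ∑ s, r s ^ p * pMonomial (fun b => algebraMap k E (v b)) s}
        zero_mem' := ⟨0, by simp [hp.out.ne_zero]⟩
        add_mem' := by
          rintro _ _ ⟨r, rfl⟩ ⟨r', rfl⟩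
          refine ⟨r + r', ?_⟩
          rw [← Finset.sum_add_distrib]
          refine Finset.sum_congr rfl fun s _ => ?_
          rw [Pi.add_apply, add_pow_expChar, add_mul] }
    have hT : x ∈ T := by
      rw [← b'.linearCombination_repr x, Finsupp.linearCombination_apply, Finsupp.sum]
      refine T.sum_mem fun i _ => ?_
      obtain ⟨r, hr⟩ := h1 (b'.repr x i)
      refine ⟨fun s => algebraMap k E (r s) * b i, ?_⟩
      rw [hr, hb', Algebra.smul_def, map_sum, Finset.sum_mul]
      refine Finset.sum_congr rfl fun s _ => ?_
      rw [map_mul, map_pMonomial, map_pow]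
      ring
    exact hT
  · apply b.ext_elem
    intro i
    have h3 := congrArg (fun x => b'.repr x i) hr
    simp only [← map_pMonomial, map_sum, Finsupp.coe_finsetSum, Finset.sum_apply,
      map_zero, Finsupp.coe_zero, Pi.zero_apply] at h3
    rw [map_zero, Finsupp.coe_zero, Pi.zero_apply]
    refine h2 (fun s => b.repr (r s) i) ?_ s
    rw [← h3]
    refine Finset.sum_congr rfl fun s _ => Eq.symm ?_
    exact repr_pow_mul b (r s) (pMonomial v s) i

end Separable

section Derivation

variable {k : Type u} [Field k] [CharP k p] {ι : Type w} [Fintype ι] [DecidableEq ι] {v : ι → k}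

omit hp [CharP k p] [DecidableEq ι] in
-- Exponents add modulo `p` in `Fin p`; the carries form the `p`-th power.
theorem exists_pMonomial_mul (v : ι → k) (s t : ι → Fin p) :
    ∃ q : k, pMonomial v s * pMonomial v t = q ^ p * pMonomial v (s + t) := by
  refine ⟨∏ b, v b ^ (((s b : ℕ) + t b) / p), ?_⟩
  rw [pMonomial, pMonomial, pMonomial, ← Finset.prod_pow, ← Finset.prod_mul_distrib,
    ← Finset.prod_mul_distrib]
  refine Finset.prod_congr rfl fun b _ => ?_
  rw [← pow_add, ← pow_mul, ← pow_add, Pi.add_apply, Fin.val_add, mul_comm, Nat.div_add_mod]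

/-- A `p`-basis determines the derivations `v b * ∂ / ∂ (v b)`. -/
theorem exists_derivation (hv : IsPBasisFamily p v) (b : ι) :
    ∃ D : Derivation ℤ k k, ∀ r : (ι → Fin p) → k,
      D (∑ s, r s ^ p * pMonomial v s) = ∑ s, ((s b : ℕ) * r s) ^ p * pMonomial v s := by
  obtain ⟨h1, h2⟩ := hv
  choose c hc using h1
  -- Thus `(s b * r) ^ p = s b * r ^ p`: the map `θ` below scales each monomial term by its exponent
  -- at `b`.
  have hnat : ∀ n : ℕ, (n : k) ^ p = n := fun n => by rw [← frobenius_def, map_natCast]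
  have huniq : ∀ r r' : (ι → Fin p) → k,
      ∑ s, r s ^ p * pMonomial v s = ∑ s, r' s ^ p * pMonomial v s → r = r' := by
    intro r r' h
    ext s
    refine sub_eq_zero.1 (h2 (r - r') ?_ s)
    simp only [Pi.sub_apply, sub_pow_expChar, sub_mul, Finset.sum_sub_distrib, h, sub_self]
  have hc' : ∀ r : (ι → Fin p) → k, c (∑ s, r s ^ p * pMonomial v s) = r := fun r =>
    (huniq _ _ (hc _)).symm
  let θ : k →+ k :=
    { toFun := fun x => ∑ s, ((s b : ℕ) * c x s) ^ p * pMonomial v s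
      map_zero' := by
        have : c 0 = 0 := by
          have := hc' 0
          simpa [hp.out.ne_zero] using this
        simp [this, hp.out.ne_zero]
      map_add' := by
        intro x y
        have : c (x + y) = c x + c y := by
          apply huniq
          rw [← hc]
          nth_rewrite 1 [hc x, hc y]
          simp only [Pi.add_apply, add_pow_expChar, add_mul, Finset.sum_add_distrib]
        simp only [this, Pi.add_apply, mul_add, add_pow_expChar, add_mul,
          Finset.sum_add_distrib] }
  have hθ : ∀ r : (ι → Fin p) → k,
      θ (∑ s, r s ^ p * pMonomial v s) = ∑ s, ((s b : ℕ) * r s) ^ p * pMonomial v s := by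
    intro r
    change ∑ s, ((s b : ℕ) * c _ s) ^ p * pMonomial v s = _
    rw [hc']
  have hθ1 : ∀ (a : k) (s : ι → Fin p),
      θ (a ^ p * pMonomial v s) = (s b : ℕ) * (a ^ p * pMonomial v s) := by
    intro a s
    have h := hθ (Pi.single s a)
    rw [Finset.sum_eq_single s, Finset.sum_eq_single s] at h
    · simp only [Pi.single_eq_same, mul_pow, hnat] at h
      rw [h, mul_assoc]
    · intro t _ hts
      simp [Pi.single_eq_of_ne hts, hp.out.ne_zero]
    · simp
    · intro t _ hts
      simp [Pi.single_eq_of_ne hts, hp.out.ne_zero]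
    · simp
  refine ⟨Derivation.mk' θ.toIntLinearMap fun x y => ?_, hθ⟩
  change θ (x * y) = x * θ y + y * θ x
  rw [hc x, hc y, Finset.sum_mul_sum, map_sum, map_sum, map_sum, Finset.sum_mul_sum,
    Finset.sum_mul_sum, Finset.sum_comm (γ := ι → Fin p) (s := Finset.univ (α := ι → Fin p))
      (f := fun i j => c y i ^ p * pMonomial v i * θ (c x j ^ p * pMonomial v j)),
    ← Finset.sum_add_distrib]
  refine Finset.sum_congr rfl fun s _ => ?_
  rw [map_sum, ← Finset.sum_add_distrib]
  refine Finset.sum_congr rfl fun t _ => ?_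
  obtain ⟨q, hq⟩ := exists_pMonomial_mul v s t
  have h3 : c x s ^ p * pMonomial v s * (c y t ^ p * pMonomial v t) =
      (c x s * c y t * q) ^ p * pMonomial v (s + t) := by
    rw [mul_mul_mul_comm, hq]
    ring
  rw [h3, hθ1, ← h3, hθ1, hθ1, Pi.add_apply, Fin.val_add, ← CharP.cast_eq_mod]
  push_cast
  ring

/-- Every derivation kills `x`. The one attached to `b` multiplies the term of exponent `s` by `s
b`, so only the term `s = 0`, a `p`-th power, survives. -/
theorem exists_pow_of_D_eq_zero (hv : IsPBasisFamily p v) {x : k}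
    (hx : KaehlerDifferential.D ℤ k x = 0) : ∃ t, x = t ^ p := by
  have hD : ∀ D : Derivation ℤ k k, D x = 0 := fun D => by
    rw [← D.liftKaehlerDifferential_comp_D, hx, map_zero]
  obtain ⟨r, hr⟩ := hv.1 x
  refine ⟨r 0, ?_⟩
  have h0 : ∀ s, s ≠ 0 → r s = 0 := by
    intro s hs
    obtain ⟨b, hb⟩ := Function.ne_iff.1 hs
    obtain ⟨D, hDb⟩ := exists_derivation hv b
    have h := hDb r
    rw [← hr, hD] at h
    have h' := hv.2 _ h.symm s
    refine (mul_eq_zero.1 h').resolve_left fun h'' => hb ?_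
    rw [CharP.cast_eq_zero_iff k p] at h''
    exact Fin.ext (Nat.eq_zero_of_dvd_of_lt h'' (s b).2)
  rw [hr, Finset.sum_eq_single 0]
  · simp [pMonomial]
  · intro s _ hs
    simp [h0 s hs, hp.out.ne_zero]
  · simp

theorem exists_pow_of_dlog_eq_zero (hv : IsPBasisFamily p v) {x : Additive kˣ}
    (hx : dlog k x = 0) : ∃ t : k, (x.toMul : k) = t ^ p := by
  refine hv.exists_pow_of_D_eq_zero ?_
  have h : ((x.toMul⁻¹ : kˣ) : k) • KaehlerDifferential.D ℤ k (x.toMul : k) = 0 := hx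
  exact (smul_eq_zero.1 h).resolve_left (Units.ne_zero _)

end Derivation

end IsPBasisFamily

end PBasisFamily


/-! ### From vanishing of `H²_ét` to universality of the norm form. -/

section ArtinSchreier

universe u v w

theorem contH1_eq_coboundary {G : Type u} [Group G] [TopologicalSpace G] {M : Type v}
    [AddCommGroup M] [DistribMulAction G M] [h : Subsingleton (ContH1 G M)] {c : G → M}
    (hc : IsLocallyConstant c) (hc' : groupCohomology.IsCocycle₁ c) :
    ∃ x : M, ∀ g, g • x - x = c g := by
  have h1 : (QuotientAddGroup.mk (⟨c, hc, hc'⟩ : contCocycles₁ G M) : ContH1 G M) = 0 :=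
    Subsingleton.elim _ _
  rw [QuotientAddGroup.eq_zero_iff] at h1
  exact h1

theorem galois_smul_dlog {k : Type u} [Field k] {F : Type v} [Field F] [Algebra k F]
    (σ : Gal(F/k)) (x : Additive Fˣ) :
    σ • (dlog F).rangeRestrict x = (dlog F).rangeRestrict
      (Additive.ofMul (Units.map ((σ : F →+* F) : F →* F) x.toMul)) :=
  LogDifferentials.map_mk _ _

open scoped Pointwise in
theorem isLocallyConstant_apply {k : Type u} [Field k] {F : Type v} [Field F] [Algebra k F]
    [Algebra.IsAlgebraic k F] (y : F) : IsLocallyConstant fun σ : Gal(F/k) => σ y := by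
  rw [IsLocallyConstant.iff_exists_open]
  intro σ
  have : FiniteDimensional k (IntermediateField.adjoin k {y}) :=
    IntermediateField.adjoin.finiteDimensional (Algebra.IsIntegral.isIntegral y)
  refine ⟨σ • ((IntermediateField.adjoin k {y}).fixingSubgroup : Set Gal(F/k)),
    (IntermediateField.fixingSubgroup_isOpen _).smul σ, ⟨1, one_mem _, mul_one _⟩, ?_⟩
  rintro _ ⟨τ, hτ, rfl⟩
  have h : τ y = y := (IntermediateField.mem_fixingSubgroup_iff _ _).1 hτ y
    (IntermediateField.mem_adjoin_simple_self k y)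
  change σ (τ y) = σ y
  rw [h]

theorem apply_eq_add_one_of_sq_add_self_eq {k : Type u} [Field k] {E : Type v} [Field E]
    [CharP E 2] [Algebra k E] {γ : k} {y : E} (hy : y ^ 2 + y = algebraMap k E γ)
    {σ : Gal(E/k)} (hσ : σ y ≠ y) : σ y = y + 1 := by
  have h := congrArg σ hy
  rw [map_add, map_pow, AlgEquiv.commutes, ← hy] at h
  have h' : (σ y - y) * (σ y - (y + 1)) = 0 := by
    linear_combination h + (y ^ 2 - σ y * y + y - σ y) * CharTwo.two_eq_zero (R := E)
  exact sub_eq_zero.1 ((mul_eq_zero.1 h').resolve_left (sub_ne_zero.2 hσ))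

/-- If `z` is an element whose class modulo squares is moved by `σ` by the factor `α` or `1`
according to whether `σ` moves a root `y` of `X² + X = γ` or not, then `α` is represented by the
norm form of `y`. -/
theorem exists_norm_of_square_classes {k : Type u} [Field k] [CharP k 2] {E : Type v} [Field E]
    [Algebra k E] [IsGalois k E] {ι : Type w} [Fintype ι] [DecidableEq ι] {v : ι → k}
    (hv : IsPBasisFamily 2 v) {γ α : k} (hα : α ≠ 0) {y : E}
    (hy : y ^ 2 + y = algebraMap k E γ) {z : E} (hz : z ≠ 0)
    (h₁ : ∀ σ : Gal(E/k), σ y = y → ∃ t, σ z = t ^ 2 * z)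
    (h₂ : ∀ σ : Gal(E/k), σ y ≠ y → ∃ t, σ z = algebraMap k E α * t ^ 2 * z)
    (hne : ∃ σ : Gal(E/k), σ y ≠ y) :
    ∃ m n, α⁻¹ = m ^ 2 + m * n + γ * n ^ 2 := by
  have : ExpChar E 2 := expChar_of_injective_algebraMap (algebraMap k E).injective 2
  have : CharP E 2 := charP_of_injective_algebraMap (algebraMap k E).injective 2
  have hsq : ∀ {a b : E}, a ^ 2 = b ^ 2 → a = b := fun h => frobenius_inj E 2 h
  have hy2 := fun σ => apply_eq_add_one_of_sq_add_self_eq hy (σ := σ)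
  obtain ⟨r, hr⟩ := (hv.map (E := E)).1 z
  have hr0 : ∃ s, r s ≠ 0 := by
    by_contra! h
    exact hz (by rw [hr]; simp [h])
  obtain ⟨s, hs⟩ := hr0
  -- The monomials are Galois-invariant, so uniqueness of coordinates applies. Dividing `z` by `r s
  -- ^ 2` therefore makes it fixed by the stabilizer of `y`.
  have hcoord : ∀ (σ : Gal(E/k)) (t : E), σ z = t ^ 2 * z → σ (r s) = t * r s := by
    intro σ t h
    rw [hr, map_sum, Finset.mul_sum, ← sub_eq_zero, ← Finset.sum_sub_distrib] at h
    refine sub_eq_zero.1 ((hv.map (E := E)).2 (fun s => σ (r s) - t * r s) ?_ s)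
    rw [← h]
    refine Finset.sum_congr rfl fun s _ => ?_
    rw [← IsPBasisFamily.map_pMonomial, map_mul, map_pow, AlgEquiv.commutes, sub_pow_expChar]
    ring
  have hz0 : ∀ σ : Gal(E/k), σ y = y → σ (z / r s ^ 2) = z / r s ^ 2 := by
    intro σ hσ
    obtain ⟨t, ht⟩ := h₁ σ hσ
    have ht0 : t ≠ 0 := by
      rintro rfl
      exact hz ((map_eq_zero σ).1 (by rw [ht]; ring))
    rw [map_div₀, map_pow, hcoord σ t ht, ht]
    field_simp
  obtain ⟨σ, hσ⟩ := hne
  obtain ⟨t₀, ht₀⟩ := h₂ σ hσ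
  set z₀ := z / r s ^ 2 with hz₀
  have hz₀0 : z₀ ≠ 0 := div_ne_zero hz (pow_ne_zero _ hs)
  have hσr : σ (r s) ≠ 0 := (map_ne_zero σ).2 hs
  set t := t₀ * r s / σ (r s) with ht
  have hσz₀ : σ z₀ = algebraMap k E α * t ^ 2 * z₀ := by
    rw [hz₀, map_div₀, map_pow, ht₀, ht]
    field_simp
  have hα' : algebraMap k E α ≠ 0 := (map_ne_zero _).2 hα
  have hmul : ∀ τ ρ : Gal(E/k), τ y ≠ y → ρ y ≠ y → (τ * ρ) y = y := by
    intro τ ρ hτ hρ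
    rw [AlgEquiv.mul_apply, hy2 ρ hρ, map_add, map_one, hy2 τ hτ, add_assoc,
      CharTwo.add_self_eq_zero, add_zero]
  have hinv : σ⁻¹ y ≠ y := by
    intro h
    apply hσ
    conv_lhs => rw [← h]
    exact σ.apply_symm_apply y
  have hσσ : ∀ x, σ (σ⁻¹ x) = x := fun x => σ.apply_symm_apply x
  have htfix : ∀ τ : Gal(E/k), τ y = y → τ t = t := by
    intro τ hτ
    have h : τ (σ z₀) = σ z₀ := by
      have h1 := hz0 (σ⁻¹ * τ * σ) (by
        have h2 : τ (σ y) = σ y := by rw [hy2 σ hσ, map_add, map_one, hτ]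
        rw [AlgEquiv.mul_apply, AlgEquiv.mul_apply, h2]
        exact σ.symm_apply_apply y)
      have h2 := congrArg σ h1
      rwa [AlgEquiv.mul_apply, AlgEquiv.mul_apply, hσσ] at h2
    rw [hσz₀, map_mul, map_mul, map_pow, AlgEquiv.commutes, hz0 τ hτ] at h
    exact hsq (mul_left_cancel₀ hα' (mul_right_cancel₀ hz₀0 h))
  have hσt : ∀ τ : Gal(E/k), τ y ≠ y → τ t = σ t := by
    intro τ hτ
    have h := htfix (σ⁻¹ * τ) (hmul _ _ hinv hτ)
    rw [AlgEquiv.mul_apply] at h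
    rw [← h, hσσ, h]
  -- Applying `σ` twice to `z₀` gives the square of this identity; square roots are unique in
  -- characteristic 2.
  have hnorm : algebraMap k E α * (t * σ t) = 1 := by
    have h := hz0 (σ * σ) (hmul σ σ hσ hσ)
    rw [AlgEquiv.mul_apply, hσz₀, map_mul, map_mul, map_pow, AlgEquiv.commutes, hσz₀] at h
    refine hsq (mul_right_cancel₀ hz₀0 ?_)
    linear_combination h
  -- `n` is the trace of `t` from `k(y)`; then `t = m + n * y`, whose norm is `m² + mn + γn²`.
  have hn : ∃ n : k, algebraMap k E n = t + σ t := by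
    refine (InfiniteGalois.mem_range_algebraMap_iff_fixed (k := k) (t + σ t)).2 fun τ => ?_
    by_cases hτ : τ y = y
    · have h : τ (σ t) = σ t := by
        have hτσ : (τ * σ) y ≠ y := by
          rw [AlgEquiv.mul_apply, hy2 σ hσ, map_add, map_one, hτ]
          simp
        exact hσt _ hτσ
      rw [map_add, htfix τ hτ, h]
    · have h : τ (σ t) = t := htfix _ (hmul τ σ hτ hσ)
      rw [map_add, hσt τ hτ, h, add_comm]
  obtain ⟨n, hn⟩ := hn
  have hm : ∃ m : k, algebraMap k E m = t + algebraMap k E n * y := by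
    refine (InfiniteGalois.mem_range_algebraMap_iff_fixed (k := k) _).2 fun τ => ?_
    rw [map_add, map_mul, AlgEquiv.commutes]
    by_cases hτ : τ y = y
    · rw [htfix τ hτ, hτ]
    · rw [hσt τ hτ, hy2 τ hτ, mul_add, mul_one]
      nth_rewrite 2 [hn]
      linear_combination σ t * CharTwo.two_eq_zero (R := E)
  obtain ⟨m, hm⟩ := hm
  refine ⟨m, n, (algebraMap k E).injective ?_⟩
  simp only [map_inv₀, map_add, map_mul, map_pow]
  rw [← hy, inv_eq_of_mul_eq_one_right hnorm, hm]
  have h2 := CharTwo.two_eq_zero (R := E)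
  rw [show σ t = algebraMap k E n - t by rw [hn]; ring]
  linear_combination (-t ^ 2 - t * algebraMap k E n * y - (algebraMap k E n) ^ 2 * y ^ 2
    - (algebraMap k E n) ^ 2 * y) * h2

/-- The cocycle `c` is the Artin–Schreier character of `γ` times `dlog α⁻¹`. Writing it as the
coboundary of `dlog z` determines how the Galois group moves `z` modulo squares, since `dlog` kills
only squares. -/
theorem exists_norm_of_subsingleton_etaleH2 {k : Type u} [Field k] [CharP k 2]
    [Subsingleton (EtaleH2TateTwist 2 k)] {ι : Type w} [Fintype ι] [DecidableEq ι] {v : ι → k}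
    (hv : IsPBasisFamily 2 v) (γ α : k) : ∃ m n, α = m ^ 2 + m * n + γ * n ^ 2 := by
  classical
  have h2k := CharTwo.two_eq_zero (R := k)
  by_cases hα : α = 0
  · exact ⟨0, 0, by simp [hα]⟩
  have : CharP (SeparableClosure k) 2 :=
    charP_of_injective_algebraMap (algebraMap k (SeparableClosure k)).injective 2
  have h2 := CharTwo.two_eq_zero (R := SeparableClosure k)
  obtain ⟨y, hy⟩ := IsSepClosed.exists_root_C_mul_X_pow_add_C_mul_X_add_C' 2 2
    (1 : SeparableClosure k) 1 (-algebraMap k _ γ) dvd_rfl le_rfl one_ne_zero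
  replace hy : y ^ 2 + y = algebraMap k _ γ := by linear_combination hy
  by_cases hne : ∀ σ : Gal(SeparableClosure k/k), σ y = y
  · obtain ⟨y₀, rfl⟩ := (InfiniteGalois.mem_range_algebraMap_iff_fixed (k := k) y).2 hne
    rw [← map_pow, ← map_add] at hy
    have hy₀ := (algebraMap k (SeparableClosure k)).injective hy
    -- The form splits as `(m + n * y₀) * (m + n * y₀ + n)`; the witnesses make the factors `α` and
    -- `1`.
    refine ⟨α - (1 + α) * y₀, 1 + α, ?_⟩
    rw [← hy₀]
    linear_combination (-α ^ 2 + α * y₀ * (1 + α) - y₀ ^ 2 * (1 + α) ^ 2) * h2k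
  push Not at hne
  have hy2 := fun σ => apply_eq_add_one_of_sq_add_self_eq hy (σ := σ)
  have hα' : algebraMap k (SeparableClosure k) α⁻¹ ≠ 0 := (map_ne_zero _).2 (inv_ne_zero hα)
  set a : Additive (SeparableClosure k)ˣ := Additive.ofMul (Units.mk0 _ hα')
  set ω := (dlog (SeparableClosure k)).rangeRestrict a
  have hω : ∀ σ : Gal(SeparableClosure k/k), σ • ω = ω := by
    intro σ
    rw [galois_smul_dlog]
    congr 1
    exact Additive.toMul.injective (Units.ext (σ.commutes α⁻¹))
  have hωω : ω + ω = 0 := by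
    rw [← two_nsmul]
    apply Subtype.ext
    change 2 • dlog (SeparableClosure k) a = 0
    rw [← Nat.cast_smul_eq_nsmul (SeparableClosure k)]
    push_cast
    rw [h2, zero_smul]
  let c : Gal(SeparableClosure k/k) → LogDifferentials (SeparableClosure k) :=
    fun σ => if σ y = y then 0 else ω
  have hc : IsLocallyConstant c :=
    (isLocallyConstant_apply (k := k) y).comp fun x => if x = y then 0 else ω
  have hc' : groupCohomology.IsCocycle₁ c := by
    intro σ τ
    change (if σ (τ y) = y then 0 else ω) =
      σ • (if τ y = y then 0 else ω) + if σ y = y then 0 else ω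
    by_cases hτ : τ y = y
    · rw [hτ, if_pos rfl, smul_zero, zero_add]
    · rw [if_neg hτ, hω, hy2 τ hτ, map_add, map_one]
      by_cases hσ : σ y = y
      · rw [if_pos hσ, hσ, if_neg (by simp), add_zero]
      · rw [if_neg hσ, hy2 σ hσ, add_assoc, CharTwo.add_self_eq_zero, add_zero, if_pos rfl, hωω]
  have hH : Subsingleton (ContH1 Gal(SeparableClosure k/k)
    (LogDifferentials (SeparableClosure k))) := ‹Subsingleton (EtaleH2TateTwist 2 k)›
  obtain ⟨x, hx⟩ := contH1_eq_coboundary hc hc'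
  obtain ⟨z, rfl⟩ := (dlog (SeparableClosure k)).rangeRestrict_surjective x
  have hdlog : ∀ (σ : Gal(SeparableClosure k/k)) (b : Additive (SeparableClosure k)ˣ),
      c σ = (dlog (SeparableClosure k)).rangeRestrict b →
        ∃ t, σ (z.toMul : SeparableClosure k) = (b.toMul : SeparableClosure k) * t ^ 2 * z.toMul := by
    intro σ b hb
    have h := hx σ
    rw [hb, galois_smul_dlog, ← map_sub, ← sub_eq_zero, ← map_sub] at h
    obtain ⟨t, ht⟩ := (hv.map (E := SeparableClosure k)).exists_pow_of_dlog_eq_zero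
      (congrArg Subtype.val h)
    refine ⟨t, ?_⟩
    rw [← ht]
    simp only [toMul_sub, toMul_ofMul, Units.val_div_eq_div_val, Units.coe_map]
    have := z.toMul.ne_zero
    have := b.toMul.ne_zero
    change σ (z.toMul : SeparableClosure k) = _ * (σ (z.toMul : SeparableClosure k) / _ / _) * _
    field_simp
  have := exists_norm_of_square_classes hv (inv_ne_zero hα) hy z.toMul.ne_zero
    (fun σ hσ => ?_) (fun σ hσ => hdlog σ a (if_neg hσ)) hne
  · simpa using this
  · obtain ⟨t, ht⟩ := hdlog σ 0 (by rw [map_zero]; exact if_pos hσ)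
    exact ⟨t, by simpa using ht⟩

end ArtinSchreier


/-! ### Milnor symbols modulo `m` as Steinberg pairings in two slots. -/

section Symbols

universe u v

theorem SteinbergPairing.pow_mul_pow_mul {F : Type u} [Field F] {M : Type v} [AddCommGroup M]
    (β : SteinbergPairing F M) {n : ℕ} (hM : ∀ x : M, n • x = 0) (s t a b : Fˣ) :
    β.toFun (s ^ n * a) (t ^ n * b) = β.toFun a b := by
  rw [mul_left, pow_left, hM, mul_right, pow_right, hM, zero_add, zero_add]

variable (F : Type u) [Field F] (m n : ℕ)

/-- The symbol `(x₁, …, xₙ) ↦ {x₁, …, xₙ}` in `K_n(F)/m`. -/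
def milnorSymbol : MultilinearMap ℤ (fun _ : Fin n => Additive Fˣ) (MilnorKMod F m n) :=
  ((MilnorK.multiples F m n).mkQ ∘ₗ (steinbergRelations F n).mkQ).compMultilinearMap
    (PiTensorProduct.tprod ℤ)

variable {F m n}

theorem MilnorKMod.nsmul_eq_zero (x : MilnorKMod F m n) : m • x = 0 := by
  obtain ⟨x, rfl⟩ := Submodule.mkQ_surjective _ x
  rw [← map_nsmul, Submodule.mkQ_apply, Submodule.Quotient.mk_eq_zero]
  exact ⟨x, by simp⟩

theorem milnorSymbol_eq_zero (x : Fin n → Additive Fˣ) {i j : Fin n} (hij : i ≠ j)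
    (h : ((x i).toMul : F) + (x j).toMul = 1) : milnorSymbol F m n x = 0 := by
  have h1 : PiTensorProduct.tprod ℤ x ∈ steinbergRelations F n := by
    refine Submodule.subset_span ⟨fun k => (x k).toMul, ?_, rfl⟩
    rcases hij.lt_or_gt with h' | h'
    · exact ⟨i, j, h', h⟩
    · exact ⟨j, i, h', by rw [add_comm]; exact h⟩
  change (MilnorK.multiples F m n).mkQ ((steinbergRelations F n).mkQ _) = 0
  rw [show (steinbergRelations F n).mkQ (PiTensorProduct.tprod ℤ x) = 0 from
    (Submodule.Quotient.mk_eq_zero _).2 h1, map_zero]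

/-- The symbol as a function of two of its entries. -/
def milnorPairing (x : Fin n → Additive Fˣ) {i j : Fin n} (hij : i ≠ j) :
    SteinbergPairing F (MilnorKMod F m n) where
  toFun a b := milnorSymbol F m n
    (Function.update (Function.update x i (Additive.ofMul a)) j (Additive.ofMul b))
  mul_left a b c := by
    simp only [Function.update_comm hij, ofMul_mul, MultilinearMap.map_update_add]
  mul_right a b c := by
    simp only [ofMul_mul, MultilinearMap.map_update_add]
  steinberg a b h := by
    refine milnorSymbol_eq_zero _ hij ?_
    simpa [Function.update_of_ne hij] using h

theorem milnorPairing_apply (x : Fin n → Additive Fˣ) {i j : Fin n} (hij : i ≠ j) (a b : Fˣ) :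
    (milnorPairing (m := m) x hij).toFun a b = milnorSymbol F m n
      (Function.update (Function.update x i (Additive.ofMul a)) j (Additive.ofMul b)) := rfl

theorem milnorPairing_self (x : Fin n → Additive Fˣ) {i j : Fin n} (hij : i ≠ j) :
    (milnorPairing (m := m) x hij).toFun (x i).toMul (x j).toMul = milnorSymbol F m n x := by
  rw [milnorPairing_apply, ofMul_toMul, ofMul_toMul, Function.update_eq_self,
    Function.update_eq_self]

theorem MilnorKMod.map_eq_zero {E : Type v} [Field E] (f : F →+* E)
    (h : ∀ x : Fin n → Fˣ, milnorSymbol E m n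
      (fun k => Additive.ofMul (Units.map (f : F →* E) (x k))) = 0) :
    MilnorKMod.map f m n = 0 := by
  refine Submodule.linearMap_qext _ (Submodule.linearMap_qext _ (PiTensorProduct.ext ?_))
  ext x
  rw [LinearMap.zero_comp, LinearMap.zero_comp]
  refine Eq.trans ?_ (h fun k => (x k).toMul)
  change (MilnorK.multiples E m n).mkQ ((steinbergRelations E n).mkQ
    (unitsTensorPowerMap f n (PiTensorProduct.tprod ℤ x))) = _
  rw [unitsTensorPowerMap, PiTensorProduct.map_tprod]
  rfl

end Symbols

section Decomposition

universe u v

/-- The units of `L` of the form `t ^ p * (1 + p * a)` with `a` in `A`. -/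
def powMulOneAddSubgroup (p : ℕ) {A : Type u} [CommRing A] (hA : IsContractive p A) (L : Type v)
    [Field L] [Algebra A L] : Subgroup Lˣ where
  carrier := {x | ∃ (t u : Lˣ) (a : A), x = t ^ p * u ∧ (u : L) = algebraMap A L (1 + p * a)}
  one_mem' := ⟨1, 1, 0, by simp, by simp⟩
  mul_mem' := by
    rintro _ _ ⟨t, u, a, rfl, hu⟩ ⟨s, v, b, rfl, hv⟩
    refine ⟨t * s, u * v, a + b + p * a * b, by rw [mul_pow, mul_mul_mul_comm], ?_⟩
    rw [Units.val_mul, hu, hv, ← map_mul]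
    congr 1
    ring
  inv_mem' := by
    rintro _ ⟨t, u, a, rfl, hu⟩
    obtain ⟨i, hi⟩ := (hA.isUnit_one_add_mul a).exists_right_inv
    refine ⟨t⁻¹, u⁻¹, -(a * i), by rw [mul_inv, inv_pow], ?_⟩
    rw [Units.val_inv_eq_inv_val]
    refine inv_eq_of_mul_eq_one_right ?_
    rw [hu, ← map_mul, ← map_one (algebraMap A L)]
    congr 1
    linear_combination (-(p : A) * a) * hi

end Decomposition

/-! ### The integral subring of `L` and the vanishing of symbols. -/

section Main

universe u v w

variable {p : ℕ} [hp : Fact p.Prime] {R : Type u} [CommRing R] [IsDomain R]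
  [IsDiscreteValuationRing R] [CharP (ResidueField R) p]

omit hp in
theorem natCast_mem_maximalIdeal : (p : R) ∈ maximalIdeal R := by
  rw [← residue_eq_zero_iff, map_natCast, CharP.cast_eq_zero]

omit hp [CharP (ResidueField R) p] in
theorem exists_pow_eq_natCast_mul (hp0 : (p : R) ≠ 0) {t : R} (ht : t ∈ maximalIdeal R) :
    ∃ (n : ℕ) (y : R), t ^ n = p * y := by
  obtain ⟨ϖ, hϖ⟩ := IsDiscreteValuationRing.exists_irreducible R
  obtain ⟨n, u, hu⟩ := IsDiscreteValuationRing.associated_pow_irreducible hp0 hϖ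
  rw [hϖ.maximalIdeal_eq, Ideal.mem_span_singleton] at ht
  obtain ⟨q, rfl⟩ := ht
  exact ⟨n, u * q ^ n, by rw [mul_pow, ← hu, mul_assoc]⟩

/-- A subring of a pseudo-perfect extension of level `1` in which Hensel type equations modulo `p`
are solvable, and on which the `p`-power map modulo `p` has the image of `R` as its image. -/
theorem IsPseudoPerfect.exists_subring [IsAdicComplete (maximalIdeal R) R] {K : Type v} [Field K]
    [Algebra R K] [IsFractionRing R K] [CharZero K] {L : Type w} [Field L] [Algebra K L]
    (hL : IsPseudoPerfect p R K 1 L) :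
    ∃ (A : Subring L) (f : R →+* A) (hA : IsContractive p A),
      (∀ r : R, ∃ a y : A, f r = a ^ p + p * y) ∧
      (∀ a : A, ∃ (r : R) (y : A), a ^ p = f r + p * y) ∧
      ∀ x : Kˣ, Units.map (algebraMap K L : K →* L) x ∈ powMulOneAddSubgroup p hA L := by
  obtain ⟨_, ⟨B, lift, ϖ, hB, hlift, hϖ, rfl⟩, root, hroot, -⟩ := hL
  let : Algebra R L := ((algebraMap K L).comp (algebraMap R K)).toAlgebra
  have : IsScalarTower R K L := IsScalarTower.of_algebraMap_eq fun _ => rfl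
  rw [pow_one] at hroot
  have hp0 : (p : R) ≠ 0 := by
    intro h
    have := congrArg (algebraMap R K) h
    rw [map_natCast, map_zero, Nat.cast_eq_zero] at this
    exact hp.out.ne_zero this
  have hΛfin : (Set.range (fun b : B => algebraMap R K (lift b)) ∪ {algebraMap R K ϖ}).Finite :=
    (Set.finite_range _).union (Set.finite_singleton _)
  have hΛR : ∀ a, ∃ r : R, root a ^ p = algebraMap R L r := by
    rintro ⟨_, ⟨b, rfl⟩ | rfl⟩
    · exact ⟨lift b, hroot _⟩
    · exact ⟨ϖ, hroot _⟩
  let A := Algebra.adjoin R (Set.range root)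
  have hfin : Module.Finite R A := by
    have := hΛfin.to_subtype
    refine Module.Finite.of_fg (fg_adjoin_of_finite (Set.finite_range root) ?_)
    rintro _ ⟨a, rfl⟩
    obtain ⟨r, hr⟩ := hΛR a
    exact IsIntegral.of_pow hp.out.pos (hr ▸ isIntegral_algebraMap)
  have hA : IsContractive p A := by
    intro c g
    simpa using exists_eq_add_mul_eval (natCast_mem_maximalIdeal (p := p) (R := R)) c g
  have hmem : ∀ a, root a ∈ A := fun a => Algebra.subset_adjoin ⟨a, rfl⟩
  let v : B → A := fun b => ⟨root ⟨algebraMap R K (lift b), Or.inl ⟨b, rfl⟩⟩, hmem _⟩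
  let z : A := ⟨root ⟨algebraMap R K ϖ, Or.inr rfl⟩, hmem _⟩
  have hv : ∀ b, v b ^ p = algebraMap R A (lift b) := fun b => Subtype.ext (hroot _)
  have hz : z ^ p = algebraMap R A ϖ := Subtype.ext (hroot _)
  have happrox : ∀ r : R, algebraMap R A r ∈ powModSubring p A :=
    algebraMap_mem_powModSubring hp0 hB hlift hϖ hv hz
  refine ⟨A.toSubring, algebraMap R A, hA, happrox, fun a => ?_, fun x => ?_⟩
  -- The `p`-th powers of the generators lie in `R`, and the `p`-power map is additive modulo `p`.
  · have h : A ≤ (powMemSubalgebra p R A).map A.val := by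
      refine Algebra.adjoin_le ?_
      rintro _ ⟨a, rfl⟩
      obtain ⟨r, hr⟩ := hΛR a
      exact ⟨⟨root a, hmem a⟩, ⟨r, 0, Subtype.ext (by simpa using hr)⟩, rfl⟩
    obtain ⟨b, hb, hba⟩ := h a.2
    rwa [show b = a from Subtype.ext hba] at hb
  · have hR : ∀ (r : R) (x : Lˣ), (x : L) = algebraMap R L r →
        x ∈ powMulOneAddSubgroup p hA L := by
      intro r x hx
      have hr0 : r ≠ 0 := by
        rintro rfl
        exact x.ne_zero (by rw [hx, map_zero])
      obtain ⟨n, u, hu⟩ := IsDiscreteValuationRing.associated_pow_irreducible hr0 hϖ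
      -- With `r = ϖ ^ n * u⁻¹` and `u⁻¹ = a ^ p + p * y`, the `p`-th power part of `r` is `(z ^ n *
      -- a) ^ p`.
      obtain ⟨a, y, hay⟩ := happrox (u⁻¹ : Rˣ)
      have ha : IsUnit a := hA.isUnit_of_pow_eq hp.out.ne_zero
        ((u⁻¹).isUnit.map (algebraMap R A)) (y := -y) (by rw [hay]; ring)
      obtain ⟨a, rfl⟩ := ha
      have hz0 : (z : L) ≠ 0 := by
        intro h
        have h1 : (z : L) ^ p = algebraMap K L (algebraMap R K ϖ) := hroot _
        rw [h, zero_pow hp.out.ne_zero, eq_comm, map_eq_zero,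
          IsFractionRing.to_map_eq_zero_iff] at h1
        exact hϖ.ne_zero h1
      have h1 := hA.isUnit_one_add_mul (((a⁻¹ : Aˣ) : A) ^ p * y)
      refine ⟨Units.mk0 _ hz0 ^ n * Units.map (algebraMap A L : A →* L) a,
        Units.map (algebraMap A L : A →* L) h1.unit, _, ?_, rfl⟩
      have hr : algebraMap R A r =
          (z ^ n * a) ^ p * (1 + p * (((a⁻¹ : Aˣ) : A) ^ p * y)) := by
        have h2 : r = ϖ ^ n * (u⁻¹ : Rˣ) := by rw [← hu, Units.mul_inv_cancel_right]
        have h3 : (a : A) ^ p * ((a⁻¹ : Aˣ) : A) ^ p = 1 := by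
          rw [← mul_pow, Units.mul_inv, one_pow]
        rw [h2, map_mul, map_pow, ← hz, hay]
        linear_combination (-(z ^ p) ^ n * p * y) * h3
      ext
      rw [hx, show algebraMap R L r = algebraMap A L (algebraMap R A r) from rfl, hr]
      rfl
    obtain ⟨r, s, hs, hrs⟩ := IsFractionRing.div_surjective (A := R) (x : K)
    have hs0 : algebraMap R K s ≠ 0 := IsFractionRing.to_map_ne_zero_of_mem_nonZeroDivisors hs
    have hr0 : algebraMap R K r ≠ 0 := by
      intro h
      exact x.ne_zero (by rw [← hrs, h, zero_div])
    have hx : x = Units.mk0 _ hr0 * (Units.mk0 _ hs0)⁻¹ := by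
      ext
      simp [← hrs, div_eq_mul_inv]
    rw [hx, map_mul, map_inv]
    exact Subgroup.mul_mem _ (hR r _ rfl) (Subgroup.inv_mem _ (hR s _ rfl))

theorem milnorSymbol_eq_zero_of_odd (hp2 : p ≠ 2) {A : Type u} [CommRing A]
    (hA : IsContractive p A) {L : Type w} [Field L] [Algebra A L] {n : ℕ} (hn : 2 ≤ n)
    (x : Fin n → Additive Lˣ) (hx : ∀ i, (x i).toMul ∈ powMulOneAddSubgroup p hA L) :
    milnorSymbol L p n x = 0 := by
  let i₀ : Fin n := ⟨0, by omega⟩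
  let i₁ : Fin n := ⟨1, by omega⟩
  have h01 : i₀ ≠ i₁ := by simp [i₀, i₁]
  have hM := MilnorKMod.nsmul_eq_zero (F := L) (m := p) (n := n)
  obtain ⟨t, u, a, htu, hu⟩ := hx i₀
  obtain ⟨s, v, b, hsv, hv⟩ := hx i₁
  rw [← milnorPairing_self x h01, htu, hsv, SteinbergPairing.pow_mul_pow_mul _ hM]
  exact SteinbergPairing.eq_zero_of_odd _ (hp.out.odd_of_ne_two hp2) hA hM u v a b hu hv

/-- The product formula in slots 0 and 1 puts some `1 + 4d` in slot 0. It pairs to zero with the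
entry `1 + 2c` of slot 2, whatever stands in slot 1. -/
theorem milnorSymbol_eq_zero_of_two {A : Type u} [CommRing A] (hA : IsContractive 2 A)
    {L : Type w} [Field L] [Algebra A L] {n : ℕ} (hn : 3 ≤ n) (x : Fin n → Additive Lˣ)
    (hx : ∀ i, (x i).toMul ∈ powMulOneAddSubgroup 2 hA L) : milnorSymbol L 2 n x = 0 := by
  let i₀ : Fin n := ⟨0, by omega⟩
  let i₁ : Fin n := ⟨1, by omega⟩
  let i₂ : Fin n := ⟨2, by omega⟩
  have h01 : i₀ ≠ i₁ := by simp [i₀, i₁]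
  have h02 : i₀ ≠ i₂ := by simp [i₀, i₂]
  have h12 : i₁ ≠ i₂ := by simp [i₁, i₂]
  have hM := MilnorKMod.nsmul_eq_zero (F := L) (m := 2) (n := n)
  obtain ⟨t, u, a, htu, hu⟩ := hx i₀
  obtain ⟨s, v, b, hsv, hv⟩ := hx i₁
  obtain ⟨q, w, c, hqw, hw⟩ := hx i₂
  rw [Nat.cast_ofNat] at hu hv hw
  rw [← milnorPairing_self x h01, htu, hsv, SteinbergPairing.pow_mul_pow_mul _ hM]
  by_cases hu1 : u = 1
  · rw [hu1, SteinbergPairing.one_left]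
  obtain ⟨d, D, m, -, hD, -, h⟩ := SteinbergPairing.exists_pairing_eq_neg hA u v a b hu hv hu1
  have h' := (milnorPairing (m := 2) (Function.update x i₁ (Additive.ofMul m))
    h02).eq_zero_of_four_mul hA hM D w d (2 * c) c 1 (by ring) hD hw
  have h'' := (milnorPairing (m := 2) (Function.update x i₁ (Additive.ofMul m))
    h02).pow_mul_pow_mul hM 1 q D w
  rw [h', one_pow, one_mul, ← hqw, milnorPairing_apply, ofMul_toMul,
    Function.update_comm h02, Function.update_comm h12, Function.update_eq_self,
    Function.update_comm h01.symm] at h''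
  rw [h, milnorPairing_apply, h'', neg_zero]

end Main

end

theorem mainTheorem1 {p : ℕ} [Fact p.Prime]
    {R : Type*} [CommRing R] [IsDomain R] [IsDiscreteValuationRing R]
    [IsAdicComplete (IsLocalRing.maximalIdeal R) R]
    {K : Type*} [Field K] [Algebra R K] [IsFractionRing R K] [CharZero K]
    [CharP (IsLocalRing.ResidueField R) p]
    {L : Type*} [Field L] [Algebra K L] (hL : IsPseudoPerfect p R K 1 L) :
    (∀ i : ℕ, 3 ≤ i → MilnorKMod.map (algebraMap K L) p i = 0) ∧
      ((p ≠ 2 ∨ Subsingleton (EtaleH2TateTwist p (IsLocalRing.ResidueField R))) →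
        MilnorKMod.map (algebraMap K L) p 2 = 0) := by
  obtain ⟨A, f, hA, happrox, hpow, hK⟩ := hL.exists_subring
  let : Algebra R A := f.toAlgebra
  refine ⟨fun n hn => MilnorKMod.map_eq_zero _ fun x => ?_,
    fun h => MilnorKMod.map_eq_zero _ fun x => ?_⟩
  all_goals rcases eq_or_ne p 2 with rfl | hp2
  · exact milnorSymbol_eq_zero_of_two hA hn _ fun i => hK (x i)
  · exact milnorSymbol_eq_zero_of_odd hp2 hA (by omega) _ fun i => hK (x i)
  · have hH := h.resolve_left (not_not.2 rfl)
    obtain ⟨-, ⟨B, -, -, hB, -⟩, -⟩ := hL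
    have h20 : (2 : R) ≠ 0 := by
      intro h
      have := congrArg (algebraMap R K) h
      rw [map_ofNat, map_zero] at this
      exact two_ne_zero this
    -- The element 2 of `K` is decomposed as well, because it occurs as a factor in the product
    -- formula.
    obtain ⟨t, s, z, hts, hs⟩ := hK (Units.mk0 2 two_ne_zero)
    obtain ⟨t₀, u, a, htu, hu⟩ := hK (x 0)
    obtain ⟨s₀, v, b, hsv, hv⟩ := hK (x 1)
    rw [Nat.cast_ofNat] at hs hu hv
    have h01 : (0 : Fin 2) ≠ 1 := by decide
    rw [← milnorPairing_self _ h01, toMul_ofMul, toMul_ofMul, htu, hsv,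
      SteinbergPairing.pow_mul_pow_mul _ MilnorKMod.nsmul_eq_zero]
    refine SteinbergPairing.eq_zero_of_two (R := R) (fun t ht => ?_) happrox hpow ?_ _ hA
      MilnorKMod.nsmul_eq_zero ⟨t, s, z, ?_, hs⟩ u v a b hu hv
    · obtain ⟨n, y, hy⟩ := exists_pow_eq_natCast_mul (p := 2) (by exact_mod_cast h20) ht
      exact ⟨n, algebraMap R A y, by rw [← map_pow, hy, map_mul, map_natCast, Nat.cast_ofNat]⟩
    · classical
      exact exists_norm_of_subsingleton_etaleH2 hB.isPBasisFamily
    · have h2 : algebraMap K L 2 = t ^ 2 * s := congrArg Units.val hts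
      rw [← h2, map_ofNat]
  · exact milnorSymbol_eq_zero_of_odd hp2 hA le_rfl _ fun i => hK (x i)
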